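/- Let $X=(X_t)_{t\ge 0}$ be an irreducible continuous-time Markov chain on a finite state space $\mathcal X$, with matrix of transition rates $Q$ (semigroup $e^{tQ}$) and invariant probability measure $\pi$, and let $X^{\leftarrow}$ be its time reversal, the Markov chain with rates $Q^*(x,y)=\frac{\pi(y)}{\pi(x)}Q(y,x)$. A superscript $x$ or $\nu$ denotes the starting point or the initial distribution, and $\tau_K=\inf\{t\ge 0: X_t\in K\}$ is the hitting time of $K\subset\mathcal X$ (and $\tau^{\leftarrow}_K$ that of the reversed chain). Let $G\subset\mathcal X$ be such that $G$ and $A:=\mathcal X\setminus G$ are non-empty, and let $\pi_A=\pi(\cdot\cap A)/\pi(A)$. Let $d_{TV}(\mu,\nu)=\frac12\sum_y|\mu(y)-\nu(y)|$. Let $R>1$, $\alpha,d,f,r\in(0,1)$, and put $$B_\alpha=\Big\{x\in A:\ \tfrac12\big[\mathbf P(\tau^x_G\le 2R)+\mathbf P(\tau^{\leftarrow x}_G\le 2R)\big]\le f^\alpha\Big\}.$$ Hypothesis $Hp.G(R,d,f,r)$ means that the following three conditions hold: * slow escape: $\mathbf P(\tau_G^{\pi_A}\le 2R)\le f$; * fast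 thermalization: $d_{TV}\big(\mathbf P(X^x_R=\cdot),\mathbf P(X^{x'}_R=\cdot)\big)\le d$ for all $x,x'\in B_\alpha$; * fast recurrence: $\sup_{x\in\mathcal X}\mathbf P(\tau^x_{B_\alpha\cup G}>R)<r$. Assume $r+2f^\alpha<\frac14$ and let $$\bar c=\tfrac12-\sqrt{\tfrac14-(r+2f^\alpha)},\qquad \varepsilon_2=4\big[\bar c+2f+f^\alpha+d\big]+f^{1-\alpha}.$$ Theorem. There are universal constants $C,\eta>0$ (independent of the chain, of $G$ and of $\alpha,R,d,f,r$) such that whenever $Hp.G(R,d,f,r)$ holds, $r+2f^\alpha<\frac14$ and $r+\varepsilon_2\le\eta$, the following is true. The quasi-stationary measure $\mu^*_A=\lim_{t\to\infty}\mathbf P(X^{\pi_A}_t=\cdot\mid\tau_G^{\pi_A}>t)$ exists (and, if any two points of $A$ communicate through jumps inside $A$, it is also the limit of $\sum_{x\in A}\pi_A(x)\,\mathbf P(X^x_t=\cdot\mid\tau^x_G>t)$), the mean exit time $T^*:=\mathbf E[\tau_G^{\mu^*_A}]$ satisfies $0<T^*<\infty$, and there is $0\le\varepsilon\le C(r+\varepsilon_2)$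 such that: 1. for every $t\ge 0$, $\ \big|\mathbf P(\tau_G^{\pi_A}/T^*\ge t)-e^{-t}\big|\le\varepsilon e^{-t}$; 2. for every $t\ge 0$, $\ \sup_{x\in B_\alpha}\big|\mathbf P(\tau_G^{x}/T^*\ge t)-e^{-t}\big|\le\varepsilon e^{-t}$; 3. for every $x\notin B_\alpha$, with $p_x:=\mathbf P(\tau_G^x>2R,\ \tau^x_{G\cup B_\alpha}\le R)$: for every $t\ge R/T^*$, $\ \big|\mathbf P(\tau_G^{x}/T^*\ge t)-p_x e^{-t}\big|\le\varepsilon e^{-t}$; moreover the lower bound $\mathbf P(\tau_G^{x}/T^*\ge t)\ge (p_x-\varepsilon)e^{-t}$ holds for every $t\ge 0$. -/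

import Mathlib

open MeasureTheory Filter Topology
open scoped NNReal ENNReal

noncomputable section

namespace HittingTime

variable {𝒳 Ω Ω' : Type*} [Fintype 𝒳] [DecidableEq 𝒳] [MeasurableSpace Ω] [MeasurableSpace Ω']

/-- A matrix of transition rates: non-negative off the diagonal, with zero row sums. -/
structure IsRateMatrix (Q : Matrix 𝒳 𝒳 ℝ) : Prop where
  nonneg : ∀ x y, x ≠ y → 0 ≤ Q x y
  row_sum : ∀ x, ∑ y, Q x y = 0

/-- Irreducibility: any state can be reached from any other along positive rates.
(Diagonal rates are non-positive, so every step is a genuine jump.) -/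
def IsIrreducibleRate (Q : Matrix 𝒳 𝒳 ℝ) : Prop :=
  ∀ x y, Relation.ReflTransGen (fun a b => 0 < Q a b) x y

/-- `π` is an invariant probability measure for the rates `Q`. -/
structure IsInvariant (Q : Matrix 𝒳 𝒳 ℝ) (π : 𝒳 → ℝ) : Prop where
  nonneg : ∀ x, 0 ≤ π x
  sum_one : ∑ x, π x = 1
  invariant : ∀ y, ∑ x, π x * Q x y = 0

/-- Rates of the time-reversed chain. -/
def reversedRates (Q : Matrix 𝒳 𝒳 ℝ) (π : 𝒳 → ℝ) : Matrix 𝒳 𝒳 ℝ :=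
  Matrix.of fun x y => π y / π x * Q y x

/-- The transition semigroup `e^{tQ}`. -/
def semigroup (Q : Matrix 𝒳 𝒳 ℝ) (t : ℝ≥0) : Matrix 𝒳 𝒳 ℝ :=
  NormedSpace.exp ((t : ℝ) • Q)

/-- The information `σ(X_u : u ≤ s)` generated by the process up to time `s`. -/
@[reducible] def past (X : ℝ≥0 → Ω → 𝒳) (s : ℝ≥0) : MeasurableSpace Ω :=
  ⨆ u : Set.Iic s, MeasurableSpace.comap (X u) ⊤

/-- `X` under the laws `(P x)` is the continuous time Markov chain with rates `Q`: under `P x` it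
starts at `x`, it has right-continuous paths, and its transitions given the past are `e^{hQ}`. -/
structure IsMarkovChain (Q : Matrix 𝒳 𝒳 ℝ) (P : 𝒳 → Measure Ω) (X : ℝ≥0 → Ω → 𝒳) : Prop where
  prob : ∀ x, IsProbabilityMeasure (P x)
  meas : ∀ t y, MeasurableSet {ω | X t ω = y}
  rightCont : ∀ ω t, ∀ᶠ s in 𝓝[≥] t, X s ω = X t ω
  start : ∀ x, (P x).real {ω | X 0 ω = x} = 1
  markov : ∀ (x : 𝒳) (s h : ℝ≥0) (y z : 𝒳) (E : Set Ω), MeasurableSet[past X s] E →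
    (P x).real (E ∩ {ω | X s ω = y ∧ X (s + h) ω = z}) =
      (P x).real (E ∩ {ω | X s ω = y}) * semigroup Q h y z

/-- First hitting time of `K`, with value `∞` if `K` is never hit. -/
def hit (X : ℝ≥0 → Ω → 𝒳) (K : Set 𝒳) (ω : Ω) : ℝ≥0∞ :=
  ⨅ (t : ℝ≥0) (_ : X t ω ∈ K), (t : ℝ≥0∞)

/-- The law of the chain with initial distribution `ν`. -/
def fromLaw (P : 𝒳 → Measure Ω) (ν : 𝒳 → ℝ) : Measure Ω :=
  ∑ x, ENNReal.ofReal (ν x) • P x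

/-- `π` conditioned on `A`. -/
def restricted (π : 𝒳 → ℝ) (A : Set 𝒳) (y : 𝒳) : ℝ :=
  A.indicator π y / ∑ z, A.indicator π z

/-- Total variation distance. -/
def dTV (μ ν : 𝒳 → ℝ) : ℝ := (1 / 2) * ∑ y, |μ y - ν y|

/-- The law of `X_t` started from `x`. -/
def evol (P : 𝒳 → Measure Ω) (X : ℝ≥0 → Ω → 𝒳) (x : 𝒳) (t : ℝ≥0) (y : 𝒳) : ℝ :=
  (P x).real {ω | X t ω = y}

/-- `m(X_t = y | τ_G > t)`, where `m` is the law of the chain with some initial distribution. -/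
def condEvol (m : Measure Ω) (X : ℝ≥0 → Ω → 𝒳) (G : Set 𝒳) (t : ℝ≥0) (y : 𝒳) : ℝ :=
  m.real {ω | X t ω = y ∧ (t : ℝ≥0∞) < hit X G ω} / m.real {ω | (t : ℝ≥0∞) < hit X G ω}

/-- The quasi-stationary measure on `A = Gᶜ` is `μ`: it is the limit, as `t → ∞`, of the law at
time `t` of the chain started from `π_A` and conditioned not to have left `A`. -/
def IsQuasiStationary (P : 𝒳 → Measure Ω) (X : ℝ≥0 → Ω → 𝒳) (π : 𝒳 → ℝ) (G : Set 𝒳)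
    (μ : 𝒳 → ℝ) : Prop :=
  Tendsto (fun t : ℝ≥0 => condEvol (fromLaw P (restricted π Gᶜ)) X G t) atTop (𝓝 μ)

/-- `μ` is the limit of the `π_A`-average of the conditioned laws of the chain started at points. -/
def IsAveragedLimit (P : 𝒳 → Measure Ω) (X : ℝ≥0 → Ω → 𝒳) (π : 𝒳 → ℝ) (G : Set 𝒳)
    (μ : 𝒳 → ℝ) : Prop :=
  Tendsto (fun (t : ℝ≥0) (y : 𝒳) => ∑ x, restricted π Gᶜ x * condEvol (P x) X G t y)
    atTop (𝓝 μ)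

/-- Any two points of `A` communicate through jumps inside `A`. -/
def IsIrreducibleOn (Q : Matrix 𝒳 𝒳 ℝ) (A : Set 𝒳) : Prop :=
  ∀ x ∈ A, ∀ y ∈ A, Relation.ReflTransGen (fun a b => 0 < Q a b ∧ b ∈ A) x y

/-- The basin `B_α`; `(P, X)` is the chain and `(P', X')` the time-reversed chain. -/
def basin (P : 𝒳 → Measure Ω) (X : ℝ≥0 → Ω → 𝒳) (P' : 𝒳 → Measure Ω') (X' : ℝ≥0 → Ω' → 𝒳)
    (G : Set 𝒳) (R : ℝ≥0) (f α : ℝ) : Set 𝒳 :=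
  {x | x ∈ Gᶜ ∧
    (1 / 2) * ((P x).real {ω | hit X G ω ≤ ((2 * R : ℝ≥0) : ℝ≥0∞)} +
      (P' x).real {ω | hit X' G ω ≤ ((2 * R : ℝ≥0) : ℝ≥0∞)}) ≤ f ^ α}

/-- Slow escape `E(R, f)`. -/
def SlowEscape (P : 𝒳 → Measure Ω) (X : ℝ≥0 → Ω → 𝒳) (π : 𝒳 → ℝ) (G : Set 𝒳) (R : ℝ≥0)
    (f : ℝ) : Prop :=
  (fromLaw P (restricted π Gᶜ)).real {ω | hit X G ω ≤ ((2 * R : ℝ≥0) : ℝ≥0∞)} ≤ f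

/-- Fast thermalization `T(R, d)` in the set `B`. -/
def FastThermalization (P : 𝒳 → Measure Ω) (X : ℝ≥0 → Ω → 𝒳) (B : Set 𝒳) (R : ℝ≥0)
    (d : ℝ) : Prop :=
  ∀ x ∈ B, ∀ x' ∈ B, dTV (evol P X x R) (evol P X x' R) ≤ d

/-- Fast recurrence `Rc(R, r)` to the set `B ∪ G`. -/
def FastRecurrence (P : 𝒳 → Measure Ω) (X : ℝ≥0 → Ω → 𝒳) (B G : Set 𝒳) (R : ℝ≥0)
    (r : ℝ) : Prop :=
  ∀ x, (P x).real {ω | (R : ℝ≥0∞) < hit X (B ∪ G) ω} < r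

/-- Hypothesis `Hp.G(R, d, f, r)`, for the basin `B_α`. -/
structure HpG (P : 𝒳 → Measure Ω) (X : ℝ≥0 → Ω → 𝒳) (P' : 𝒳 → Measure Ω')
    (X' : ℝ≥0 → Ω' → 𝒳) (π : 𝒳 → ℝ) (G : Set 𝒳) (α : ℝ) (R : ℝ≥0) (d f r : ℝ) : Prop where
  R_gt : 1 < R
  d_mem : d ∈ Set.Ioo (0 : ℝ) 1
  f_mem : f ∈ Set.Ioo (0 : ℝ) 1
  r_mem : r ∈ Set.Ioo (0 : ℝ) 1
  slowEscape : SlowEscape P X π G R f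
  recurrence : FastRecurrence P X (basin P X P' X' G R f α) G R r
  thermalization : FastThermalization P X (basin P X P' X' G R f α) R d

/-- `c̄ = 1/2 - √(1/4 - c)` with `c = r + 2 f^α`. -/
def cBar (α f r : ℝ) : ℝ := 1 / 2 - √(1 / 4 - (r + 2 * f ^ α))

/-- `ε₂ = 4 [c̄ + 2 f + f^α + d] + f^{1-α}`. -/
def eps2 (α d f r : ℝ) : ℝ := 4 * (cBar α f r + 2 * f + f ^ α + d) + f ^ (1 - α)

end HittingTime

end

/-!
Kill the chain on `G` and let `B` be the basin. Slow escape, fast thermalization and fast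
recurrence say that the killed semigroup loses little mass on `B` during a time `2R`, forgets its
starting point in `B`, and brings back to `B` almost all of the mass that survives. Hence the
deviation from a multiple of the survival probability contracts by a factor two in each time step
`2R`, so the law conditioned on survival converges to a left eigenvector `μ` of the killed
semigroup. Survival from `μ` is exactly exponential, and survival from any other initial law is
compared with survival from `μ` through the first entrance into the basin. Markov's inequality,
applied to the escape probabilities of the chain and of its reversal, which have the same mean
under the invariant law, shows that the basin carries most of the invariant mass of `A`.
-/

noncomputable section

namespace HittingTime

open Matrix

section FiniteSums

variable {𝒳 : Type*} [Fintype 𝒳] {u φ ψ : 𝒳 → ℝ}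

lemma abs_dotProduct_le_dotProduct (hu : 0 ≤ u) (hφ : ∀ y, |φ y| ≤ ψ y) :
    |u ⬝ᵥ φ| ≤ u ⬝ᵥ ψ := by
  refine (Finset.abs_sum_le_sum_abs _ _).trans (Finset.sum_le_sum fun y _ => ?_)
  rw [abs_mul, abs_of_nonneg (hu y)]
  exact mul_le_mul_of_nonneg_left (hφ y) (hu y)

lemma abs_dotProduct_le_sum_abs_mul {H : ℝ} (hφ : ∀ y, |φ y| ≤ H) :
    |u ⬝ᵥ φ| ≤ (∑ y, |u y|) * H := by
  rw [Finset.sum_mul]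
  refine (Finset.abs_sum_le_sum_abs _ _).trans (Finset.sum_le_sum fun y _ => ?_)
  rw [abs_mul]
  exact mul_le_mul_of_nonneg_left (hφ y) (abs_nonneg _)

lemma dotProduct_le_of_forall_le {H : ℝ} (hu : 0 ≤ u) (hu1 : ∑ x, u x = 1) (hφ : ∀ y, φ y ≤ H) :
    u ⬝ᵥ φ ≤ H := by
  calc u ⬝ᵥ φ ≤ ∑ x, u x * H :=
        Finset.sum_le_sum fun x _ => mul_le_mul_of_nonneg_left (hφ x) (hu x)
    _ = H := by rw [← Finset.sum_mul, hu1, one_mul]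

end FiniteSums

section SubMarkov

variable {𝒳 : Type*} [Fintype 𝒳]

/-- The total mass of the kernels `S t`: when `S` is the semigroup of a killed process, `mass S t x`
is the probability that the process started at `x` is still alive at time `t`. -/
def mass (S : ℝ≥0 → Matrix 𝒳 𝒳 ℝ) (t : ℝ≥0) : 𝒳 → ℝ := S t *ᵥ 1

lemma sum_eq_mass (S : ℝ≥0 → Matrix 𝒳 𝒳 ℝ) (t : ℝ≥0) (x : 𝒳) : ∑ y, S t x y = mass S t x :=
  (dotProduct_one _).symm

/-- A semigroup of sub-Markov kernels on a finite set, in continuous time. The identity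
`S 0 = 1` is not required: it fails for a process killed on a set of states. -/
structure IsSubMarkovSemigroup (S : ℝ≥0 → Matrix 𝒳 𝒳 ℝ) : Prop where
  nonneg : ∀ t x y, 0 ≤ S t x y
  add : ∀ s t, S (s + t) = S s * S t
  mass_le : ∀ t x, mass S t x ≤ 1

namespace IsSubMarkovSemigroup

variable {S : ℝ≥0 → Matrix 𝒳 𝒳 ℝ} (hS : IsSubMarkovSemigroup S)
include hS

lemma mass_nonneg (t : ℝ≥0) (x : 𝒳) : 0 ≤ mass S t x :=
  dotProduct_nonneg_of_nonneg (hS.nonneg t x) fun _ => zero_le_one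

lemma mulVec_add (s t : ℝ≥0) (φ : 𝒳 → ℝ) : S (s + t) *ᵥ φ = S s *ᵥ (S t *ᵥ φ) := by
  rw [hS.add, mulVec_mulVec]

lemma mass_add (s t : ℝ≥0) : mass S (s + t) = S s *ᵥ mass S t :=
  hS.mulVec_add s t 1

lemma mass_anti {s t : ℝ≥0} (hst : s ≤ t) (x : 𝒳) : mass S t x ≤ mass S s x := by
  obtain ⟨u, rfl⟩ := exists_add_of_le hst
  rw [hS.mass_add]
  exact dotProduct_le_dotProduct_of_nonneg_left (hS.mass_le u) (hS.nonneg s x)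

lemma abs_mulVec_le (t : ℝ≥0) {φ : 𝒳 → ℝ} {H : ℝ} (hφ : ∀ y, |φ y| ≤ H) (x : 𝒳) :
    |(S t *ᵥ φ) x| ≤ H * mass S t x := by
  refine (abs_dotProduct_le_sum_abs_mul hφ).trans_eq ?_
  simp only [mass, mulVec, dotProduct, Pi.one_apply, mul_one, abs_of_nonneg (hS.nonneg t x _),
    mul_comm]

lemma abs_mulVec_le_of_forall_abs_le (t : ℝ≥0) {φ : 𝒳 → ℝ} {H : ℝ} (hφ : ∀ y, |φ y| ≤ H)
    (x : 𝒳) : |(S t *ᵥ φ) x| ≤ H :=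
  (hS.abs_mulVec_le t hφ x).trans <|
    mul_le_of_le_one_right ((abs_nonneg _).trans (hφ x)) (hS.mass_le t x)

end IsSubMarkovSemigroup

/-- The mean of `φ` under the kernel `S t x` normalized to a probability measure, that is, under
the law at time `t` of the process conditioned to be still alive. -/
def normalizedMean (S : ℝ≥0 → Matrix 𝒳 𝒳 ℝ) (x : 𝒳) (φ : 𝒳 → ℝ) (t : ℝ≥0) : ℝ :=
  (S t *ᵥ φ) x / mass S t x

/-- By how much `S t *ᵥ φ` fails to be proportional to the mass, with the coefficient read off at
the reference point `x₀`. It vanishes when the conditioned process has forgotten its start. -/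
def deviation (S : ℝ≥0 → Matrix 𝒳 𝒳 ℝ) (x₀ : 𝒳) (φ : 𝒳 → ℝ) (t : ℝ≥0) : 𝒳 → ℝ :=
  S t *ᵥ φ - normalizedMean S x₀ φ t • mass S t

/-- The survival probability at time `t` under the initial law `μ`. -/
def decay (S : ℝ≥0 → Matrix 𝒳 𝒳 ℝ) (μ : 𝒳 → ℝ) (t : ℝ≥0) : ℝ :=
  μ ⬝ᵥ mass S t

/-- A quasi-stationary law of the semigroup `S`: a probability vector which is a left eigenvector
of every `S u`. -/
structure IsEigenLaw (S : ℝ≥0 → Matrix 𝒳 𝒳 ℝ) (μ : 𝒳 → ℝ) : Prop where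
  nonneg : 0 ≤ μ
  sum_one : ∑ y, μ y = 1
  eigen : ∀ u, μ ᵥ* S u = decay S μ u • μ

/-- `μ` is the limit of the law conditioned on survival, for every initial law whose survival
probability is at least a multiple of that of the point `b`. -/
def IsYaglomLimit (S : ℝ≥0 → Matrix 𝒳 𝒳 ℝ) (b : 𝒳) (μ : 𝒳 → ℝ) : Prop :=
  ∀ ν : 𝒳 → ℝ, 0 ≤ ν → ∑ x, ν x = 1 → ∀ c > 0, (∀ t, c * mass S t b ≤ ν ⬝ᵥ mass S t) →
    Tendsto (fun t y => (ν ᵥ* S t) y / ν ⬝ᵥ mass S t) atTop (𝓝 μ)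

namespace IsSubMarkovSemigroup

variable {S : ℝ≥0 → Matrix 𝒳 𝒳 ℝ} (hS : IsSubMarkovSemigroup S)
include hS

lemma deviation_add (s t : ℝ≥0) {x₀ : 𝒳} (hpos : mass S (s + t) x₀ ≠ 0) (φ : 𝒳 → ℝ) :
    deviation S x₀ φ (s + t) = S s *ᵥ deviation S x₀ φ t -
      ((S s *ᵥ deviation S x₀ φ t) x₀ / mass S (s + t) x₀) • mass S (s + t) := by
  have hψ : S s *ᵥ deviation S x₀ φ t =
      S (s + t) *ᵥ φ - normalizedMean S x₀ φ t • mass S (s + t) := by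
    rw [deviation, mulVec_sub, mulVec_smul, hS.mulVec_add, hS.mass_add]
  ext y
  simp only [hψ]
  simp only [deviation, normalizedMean, Pi.sub_apply, Pi.smul_apply, smul_eq_mul]
  field_simp
  ring

lemma abs_normalizedMean_le (t : ℝ≥0) {φ : 𝒳 → ℝ} (hφ : ∀ y, |φ y| ≤ 1) {x₀ : 𝒳}
    (hpos : 0 < mass S t x₀) : |normalizedMean S x₀ φ t| ≤ 1 := by
  rw [normalizedMean, abs_div, abs_of_pos hpos, div_le_iff₀ hpos]
  exact hS.abs_mulVec_le t hφ x₀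

lemma abs_deviation_le_two (t : ℝ≥0) {φ : 𝒳 → ℝ} (hφ : ∀ y, |φ y| ≤ 1) {x₀ : 𝒳}
    (hpos : 0 < mass S t x₀) (x : 𝒳) : |deviation S x₀ φ t x| ≤ 2 := by
  have hmean := hS.abs_normalizedMean_le t hφ hpos
  calc |deviation S x₀ φ t x| ≤ |(S t *ᵥ φ) x| + |normalizedMean S x₀ φ t| * |mass S t x| :=
        (abs_sub _ _).trans_eq (by rw [Pi.smul_apply, smul_eq_mul, abs_mul])
    _ ≤ 1 + 1 * 1 := by
        gcongr
        · exact hS.abs_mulVec_le_of_forall_abs_le t hφ x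
        · rw [abs_of_nonneg (hS.mass_nonneg t x)]
          exact hS.mass_le t x
    _ = 2 := by norm_num

lemma tendsto_mass_ratio {x₀ : 𝒳} {μ : 𝒳 → ℝ}
    (hμ : ∀ y, Tendsto (fun t => S t x₀ y / mass S t x₀) atTop (𝓝 (μ y))) (u : ℝ≥0) :
    Tendsto (fun t => mass S (t + u) x₀ / mass S t x₀) atTop (𝓝 (decay S μ u)) := by
  refine (tendsto_finsetSum Finset.univ fun z _ => (hμ z).mul_const (mass S u z)).congr fun t => ?_
  simp only [hS.mass_add, mulVec, dotProduct, Finset.sum_div, div_mul_eq_mul_div]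

lemma isEigenLaw_of_tendsto {x₀ : 𝒳} (hpos : ∀ t, 0 < mass S t x₀) {μ : 𝒳 → ℝ}
    (hμ : ∀ y, Tendsto (fun t => S t x₀ y / mass S t x₀) atTop (𝓝 (μ y))) : IsEigenLaw S μ where
  nonneg y := ge_of_tendsto' (hμ y) fun t => div_nonneg (hS.nonneg t x₀ y) (hpos t).le
  sum_one := by
    refine tendsto_nhds_unique (tendsto_finsetSum Finset.univ fun y _ => hμ y)
      (tendsto_const_nhds.congr fun t => ?_)
    rw [← Finset.sum_div, sum_eq_mass, div_self (hpos t).ne']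
  eigen u := by
    ext y
    have hleft : Tendsto (fun t => S (t + u) x₀ y / mass S t x₀) atTop (𝓝 ((μ ᵥ* S u) y)) := by
      refine (tendsto_finsetSum Finset.univ fun z _ => (hμ z).mul_const (S u z y)).congr
        fun t => ?_
      simp only [hS.add, mul_apply, Finset.sum_div, div_mul_eq_mul_div]
    have hright := (hS.tendsto_mass_ratio hμ u).mul
      ((hμ y).comp (tendsto_atTop_mono (fun t => le_self_add (b := u)) tendsto_id))
    refine tendsto_nhds_unique hleft (hright.congr fun t => ?_)
    rw [Function.comp_apply, id_eq, mul_comm, div_mul_div_cancel₀ (hpos (t + u)).ne']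

end IsSubMarkovSemigroup

namespace IsEigenLaw

variable {S : ℝ≥0 → Matrix 𝒳 𝒳 ℝ} {μ : 𝒳 → ℝ} (hμ : IsEigenLaw S μ)
  (hS : IsSubMarkovSemigroup S)
include hμ hS

lemma decay_add (u v : ℝ≥0) : decay S μ (u + v) = decay S μ u * decay S μ v := by
  rw [decay, hS.mass_add, dotProduct_mulVec, hμ.eigen, smul_dotProduct, smul_eq_mul, decay, decay]

lemma decay_nonneg (u : ℝ≥0) : 0 ≤ decay S μ u :=
  dotProduct_nonneg_of_nonneg hμ.nonneg (hS.mass_nonneg u)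

lemma decay_anti {u v : ℝ≥0} (huv : u ≤ v) : decay S μ v ≤ decay S μ u :=
  dotProduct_le_dotProduct_of_nonneg_left (hS.mass_anti huv) hμ.nonneg

lemma decay_nat_mul (n : ℕ) (u : ℝ≥0) : decay S μ ((n + 1 : ℕ) * u) = decay S μ u ^ (n + 1) := by
  induction n with
  | zero => rw [Nat.cast_one, one_mul, pow_one]
  | succ n ih => rw [Nat.cast_succ, add_mul, one_mul, hμ.decay_add hS, ih, pow_succ _ (n + 1)]

end IsEigenLaw

end SubMarkov

section ReturnKernel

variable {𝒳 : Type*} [Fintype 𝒳]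

/-- A sub-Markov semigroup `S` which loses little mass on `B` during a time `2R`, forgets its
starting point in `B` during a time `R`, and returns to `B`: `q x` stands for the probability to
visit `B` from `x` before time `R` and before being killed. All errors are bounded by `κ`. -/
structure IsReturnKernel (S : ℝ≥0 → Matrix 𝒳 𝒳 ℝ) (B : Set 𝒳) (q : 𝒳 → ℝ) (R : ℝ≥0) (κ : ℝ) :
    Prop extends IsSubMarkovSemigroup S where
  κ_nonneg : 0 ≤ κ
  κ_le : κ ≤ 1 / 100
  R_pos : 0 < R
  nonempty : B.Nonempty
  q_nonneg : ∀ x, 0 ≤ q x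
  q_le : ∀ x, q x ≤ 1
  lower : ∀ s x L, (∀ b ∈ B, L ≤ mass S (s + R) b) → q x * L ≤ mass S (s + R) x
  upper : ∀ s x H U, (∀ y, mass S s y ≤ H) → (∀ b ∈ B, mass S s b ≤ U) →
    mass S (s + R) x ≤ κ * H + q x * U
  ret : ∀ x, mass S R x - κ ≤ q x
  slow : ∀ b ∈ B, 1 - κ ≤ mass S (2 * R) b
  therm : ∀ x ∈ B, ∀ x' ∈ B, ∑ y, |S R x y - S R x' y| ≤ 2 * κ
  leave : ∀ x, (S (2 * R) *ᵥ Bᶜ.indicator 1) x ≤ κ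

namespace IsReturnKernel

variable {S : ℝ≥0 → Matrix 𝒳 𝒳 ℝ} {B : Set 𝒳} {q : 𝒳 → ℝ} {R : ℝ≥0} {κ : ℝ}
  (h : IsReturnKernel S B q R κ)
include h

lemma mass_basin_ge {s : ℝ≥0} (hs : s ≤ 2 * R) {b : 𝒳} (hb : b ∈ B) : 1 - κ ≤ mass S s b :=
  (h.slow b hb).trans (h.mass_anti hs b)

lemma dotProduct_mass_ge {ν : 𝒳 → ℝ} (hν : 0 ≤ ν) {s : ℝ≥0} {M : ℝ} (hM0 : 0 ≤ M)
    (hM : ∀ b ∈ B, M ≤ mass S (s + R) b) :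
    (ν ⬝ᵥ mass S R - κ * ∑ x, ν x) * M ≤ ν ⬝ᵥ mass S (s + R) := by
  calc (ν ⬝ᵥ mass S R - κ * ∑ x, ν x) * M = ∑ x, ν x * ((mass S R x - κ) * M) := by
        rw [dotProduct, Finset.mul_sum, ← Finset.sum_sub_distrib, Finset.sum_mul]
        exact Finset.sum_congr rfl fun x _ => by ring
    _ ≤ ν ⬝ᵥ mass S (s + R) := Finset.sum_le_sum fun x _ => mul_le_mul_of_nonneg_left
        ((mul_le_mul_of_nonneg_right (h.ret x) hM0).trans (h.lower s x M hM)) (hν x)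

lemma mass_basin_step {s : ℝ≥0} {M : ℝ} (hM0 : 0 ≤ M) (hM : ∀ b ∈ B, M ≤ mass S s b)
    {b : 𝒳} (hb : b ∈ B) : (1 - 2 * κ) * M ≤ mass S (s + R) b := by
  have hκ := h.κ_nonneg
  rcases le_total s R with hs | hs
  · have hslow := h.mass_basin_ge (s := s + R) (by rw [two_mul]; gcongr) hb
    have hM1 : M ≤ 1 := (hM b hb).trans (h.mass_le _ _)
    nlinarith [h.κ_le]
  · obtain ⟨u, rfl⟩ := exists_add_of_le hs
    have hstep : (mass S (R + R) b - κ * mass S R b) * M ≤ mass S (R + (u + R)) b := by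
      rw [h.mass_add, h.mass_add R (u + R), ← sum_eq_mass]
      exact h.dotProduct_mass_ge (h.nonneg R b) hM0 (by rwa [add_comm u R])
    have hslow := h.slow b hb
    rw [two_mul] at hslow
    rw [add_comm R u, add_comm (u + R)]
    refine le_trans (mul_le_mul_of_nonneg_right ?_ hM0) hstep
    nlinarith [h.mass_le R b]

lemma mass_basin_iterate {s : ℝ≥0} {M : ℝ} (hM0 : 0 ≤ M) (hM : ∀ b ∈ B, M ≤ mass S s b)
    (n : ℕ) {t : ℝ≥0} (ht : t ≤ n * R) {b : 𝒳} (hb : b ∈ B) :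
    (1 - 2 * κ) ^ n * M ≤ mass S (s + t) b := by
  have hκ := h.κ_le
  suffices ∀ b ∈ B, (1 - 2 * κ) ^ n * M ≤ mass S (s + n * R) b from
    (this b hb).trans (h.mass_anti (by gcongr) b)
  clear ht hb
  induction n with
  | zero => simpa using hM
  | succ n ih =>
    intro b hb
    rw [pow_succ', mul_assoc, Nat.cast_succ, add_mul, one_mul, ← add_assoc]
    exact h.mass_basin_step (mul_nonneg (pow_nonneg (by linarith) n) hM0) ih hb

lemma exists_nat_mul_ge (t : ℝ≥0) : ∃ n : ℕ, t ≤ n * R := by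
  obtain ⟨n, hn⟩ := exists_nat_ge (t / R)
  exact ⟨n, by rwa [div_le_iff₀ h.R_pos] at hn⟩

lemma mass_basin_pos {b : 𝒳} (hb : b ∈ B) (s : ℝ≥0) : 0 < mass S s b := by
  have hκ := h.κ_le
  obtain ⟨n, hn⟩ := h.exists_nat_mul_ge s
  have hbound := h.mass_basin_iterate (s := 0) (M := 1 - κ) (by linarith)
    (fun b hb => h.mass_basin_ge zero_le hb) n hn hb
  rw [zero_add] at hbound
  exact (mul_pos (pow_pos (by linarith) n) (by linarith)).trans_le hbound

lemma abs_mulVec_sub_le {φ : 𝒳 → ℝ} {H : ℝ} (hφ : ∀ y, |φ y| ≤ H) {x x' : 𝒳} (hx : x ∈ B)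
    (hx' : x' ∈ B) : |(S R *ᵥ φ) x - (S R *ᵥ φ) x'| ≤ 2 * κ * H := by
  have hH : 0 ≤ H := (abs_nonneg _).trans (hφ x)
  calc |(S R *ᵥ φ) x - (S R *ᵥ φ) x'| = |(S R x - S R x') ⬝ᵥ φ| := by
        rw [sub_dotProduct]; rfl
    _ ≤ (∑ y, |S R x y - S R x' y|) * H := abs_dotProduct_le_sum_abs_mul hφ
    _ ≤ 2 * κ * H := mul_le_mul_of_nonneg_right (h.therm x hx x' hx') hH

lemma mass_le_of_basin_min {s : ℝ≥0} {b₀ b₁ : 𝒳} (hb₁ : b₁ ∈ B)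
    (h₀ : ∀ x, mass S s x ≤ 2 * mass S s b₀)
    (h₁ : ∀ x, mass S (s + R) x ≤ 2 * mass S (s + R) b₁) (x : 𝒳) :
    mass S (s + R + R) x ≤ (1 + 2 * κ) * mass S (s + R) b₁ + 4 * κ * mass S s b₀ := by
  have hκ := h.κ_nonneg
  have hbasin : ∀ b ∈ B, mass S (s + R) b ≤ mass S (s + R) b₁ + 4 * κ * mass S s b₀ := by
    intro b hb
    have hclose := h.abs_mulVec_sub_le
      (fun y => (abs_of_nonneg (h.mass_nonneg s y)).trans_le (h₀ y)) hb hb₁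
    rw [← h.mass_add, add_comm R s] at hclose
    linarith [(abs_le.mp hclose).2]
  have hup := h.upper (s + R) x _ _ h₁ hbasin
  have hU : 0 ≤ mass S (s + R) b₁ + 4 * κ * mass S s b₀ :=
    add_nonneg (h.mass_nonneg _ _) (mul_nonneg (by linarith) (h.mass_nonneg _ _))
  linarith [mul_le_of_le_one_left hU (h.q_le x)]

lemma mass_le_basin_step {s : ℝ≥0} (h₀ : ∀ x, ∀ b ∈ B, mass S s x ≤ 2 * mass S s b)
    (h₁ : ∀ x, ∀ b ∈ B, mass S (s + R) x ≤ 2 * mass S (s + R) b) (x : 𝒳) {b : 𝒳} (hb : b ∈ B) :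
    mass S (s + R + R) x ≤ (1 + 10 * κ) * mass S (s + R + R) b := by
  have hκ := h.κ_nonneg
  have hκ' := h.κ_le
  obtain ⟨b₀, hb₀, hmin₀⟩ := Set.exists_min_image B (mass S s) (Set.toFinite B) h.nonempty
  obtain ⟨b₁, hb₁, hmin₁⟩ := Set.exists_min_image B (mass S (s + R)) (Set.toFinite B) h.nonempty
  set m₀ := mass S s b₀
  set m₁ := mass S (s + R) b₁
  set m₂ := mass S (s + R + R) b
  have hm₀ : 0 ≤ m₀ := h.mass_nonneg _ _
  have hm₁ : 0 ≤ m₁ := h.mass_nonneg _ _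
  have hm₂ : 0 ≤ m₂ := h.mass_nonneg _ _
  have hstep₀ : (1 - 2 * κ) * m₀ ≤ m₁ := h.mass_basin_step hm₀ hmin₀ hb₁
  have hstep₁ : (1 - 2 * κ) * m₁ ≤ m₂ := h.mass_basin_step hm₁ hmin₁ hb
  have hinv : 1 ≤ (1 + 3 * κ) * (1 - 2 * κ) := by nlinarith
  have h₀₁ : m₀ ≤ (1 + 3 * κ) * m₁ := by
    nlinarith [mul_le_mul_of_nonneg_right hinv hm₀]
  have h₁₂ : m₁ ≤ (1 + 3 * κ) * m₂ := by
    nlinarith [mul_le_mul_of_nonneg_right hinv hm₁]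
  calc mass S (s + R + R) x ≤ (1 + 2 * κ) * m₁ + 4 * κ * m₀ :=
        h.mass_le_of_basin_min hb₁ (fun x => h₀ x b₀ hb₀) (fun x => h₁ x b₁ hb₁) x
    _ ≤ (1 + 2 * κ) * m₁ + 4 * κ * ((1 + 3 * κ) * m₁) := by gcongr
    _ = (1 + 2 * κ + 4 * κ * (1 + 3 * κ)) * m₁ := by ring
    _ ≤ (1 + 2 * κ + 4 * κ * (1 + 3 * κ)) * ((1 + 3 * κ) * m₂) := by gcongr
    _ = (1 + 2 * κ + 4 * κ * (1 + 3 * κ)) * (1 + 3 * κ) * m₂ := by ring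
    _ ≤ (1 + 10 * κ) * m₂ := by
        refine mul_le_mul_of_nonneg_right ?_ hm₂
        nlinarith [mul_nonneg hκ hκ, mul_nonneg hκ (mul_nonneg hκ hκ)]

lemma mass_le_basin_of_le {s : ℝ≥0} (hs : s ≤ 2 * R) (x : 𝒳) {b : 𝒳} (hb : b ∈ B) :
    mass S s x ≤ (1 + 10 * κ) * mass S s b := by
  nlinarith [h.mass_basin_ge hs hb, h.mass_le s x, h.κ_nonneg, h.κ_le]

lemma mass_le_basin (s : ℝ≥0) (x : 𝒳) {b : 𝒳} (hb : b ∈ B) :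
    mass S s x ≤ (1 + 10 * κ) * mass S s b := by
  obtain ⟨n, hn⟩ := h.exists_nat_mul_ge s
  induction n generalizing s x b with
  | zero => exact h.mass_le_basin_of_le (hn.trans (by simp)) x hb
  | succ n ih =>
    rcases le_total s (2 * R) with hs | hs
    · exact h.mass_le_basin_of_le hs x hb
    · obtain ⟨u, rfl⟩ := exists_add_of_le hs
      rw [show 2 * R + u = u + R + R by ring] at hn ⊢
      rw [Nat.cast_succ, add_mul, one_mul] at hn
      have hdouble : ∀ v ≤ n * R, ∀ x, ∀ b ∈ B, mass S v x ≤ 2 * mass S v b := by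
        intro v hv x b hb
        nlinarith [ih v x hb hv, h.mass_nonneg v b, h.κ_le]
      have hu := le_of_add_le_add_right hn
      exact h.mass_le_basin_step (hdouble u (le_self_add.trans hu)) (hdouble _ hu) x hb

lemma mass_le_two_mul_basin (s : ℝ≥0) (x : 𝒳) {b : 𝒳} (hb : b ∈ B) :
    mass S s x ≤ 2 * mass S s b := by
  nlinarith [h.mass_le_basin s x hb, h.mass_nonneg s b, h.κ_le]

lemma mass_add_ge (s : ℝ≥0) (x : 𝒳) (n : ℕ) {t : ℝ≥0} (ht : t ≤ n * R) {b : 𝒳} (hb : b ∈ B) :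
    (1 - 2 * κ) ^ n * mass S s x ≤ 2 * mass S (s + t) b := by
  have hiter := h.mass_basin_iterate (s := s) (M := mass S s x / 2)
    (by linarith [h.mass_nonneg s x])
    (fun b hb => by linarith [h.mass_le_two_mul_basin s x hb]) n ht hb
  linarith

end IsReturnKernel

end ReturnKernel

section YaglomLimit

variable {𝒳 : Type*} [Fintype 𝒳] {S : ℝ≥0 → Matrix 𝒳 𝒳 ℝ} {B : Set 𝒳} {q : 𝒳 → ℝ} {R : ℝ≥0}
  {κ : ℝ}

/-- The two-scale bound propagated by the contraction argument: `ψ` is of size `e` on `B`, and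
possibly ten times larger elsewhere. -/
def IsTwoScaleBounded (B : Set 𝒳) (e : ℝ) (ψ : 𝒳 → ℝ) : Prop :=
  (∀ x, |ψ x| ≤ 10 * e) ∧ ∀ x ∈ B, |ψ x| ≤ e

namespace IsReturnKernel

variable (h : IsReturnKernel S B q R κ)
include h

lemma abs_mulVec_two_mul_le {φ : 𝒳 → ℝ} {β D : ℝ} (hβ : ∀ y ∈ B, |φ y| ≤ β)
    (hD : ∀ y, |φ y| ≤ D) (x : 𝒳) : |(S (2 * R) *ᵥ φ) x| ≤ β + κ * D := by
  obtain ⟨b, hb⟩ := h.nonempty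
  have hβ0 : 0 ≤ β := (abs_nonneg _).trans (hβ b hb)
  have hD0 : 0 ≤ D := (abs_nonneg _).trans (hD b)
  have hφ : ∀ y, |φ y| ≤ (β • (1 : 𝒳 → ℝ) + D • Bᶜ.indicator (1 : 𝒳 → ℝ) : 𝒳 → ℝ) y := by
    intro y
    by_cases hy : y ∈ B
    · simpa [hy] using hβ y hy
    · simpa [hy] using (hD y).trans (le_add_of_nonneg_left hβ0)
  calc |(S (2 * R) *ᵥ φ) x| ≤ β * mass S (2 * R) x + D * (S (2 * R) *ᵥ Bᶜ.indicator 1) x := by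
        refine (abs_dotProduct_le_dotProduct (h.nonneg _ x) hφ).trans_eq ?_
        rw [dotProduct_add, dotProduct_smul, dotProduct_smul]
        rfl
    _ ≤ β * 1 + D * κ := by
        gcongr
        · exact h.mass_le _ x
        · exact h.leave x
    _ = β + κ * D := by ring

lemma abs_mulVec_two_mul_sub_le {φ : 𝒳 → ℝ} {D : ℝ} (hD : ∀ y, |φ y| ≤ D) {x x' : 𝒳}
    (hx : x ∈ B) (hx' : x' ∈ B) :
    |(S (2 * R) *ᵥ φ) x - (S (2 * R) *ᵥ φ) x'| ≤ 2 * κ * D := by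
  rw [two_mul, h.mulVec_add]
  exact h.abs_mulVec_sub_le (h.abs_mulVec_le_of_forall_abs_le R hD) hx hx'

lemma abs_one_sub_mass_ratio_le (s : ℝ≥0) {x x₀ : 𝒳} (hx : x ∈ B) (hx₀ : x₀ ∈ B) :
    |1 - mass S s x / mass S s x₀| ≤ 10 * κ := by
  have hκ := h.κ_nonneg
  have hpos := h.mass_basin_pos hx₀ s
  have hle := h.mass_le_basin s x₀ hx
  rw [abs_le, neg_le_sub_iff_le_add, div_le_iff₀ hpos, sub_le_comm, le_div_iff₀ hpos]
  constructor
  · linarith [h.mass_le_basin s x hx₀]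
  · nlinarith [mul_le_mul_of_nonneg_left hle hκ, mul_nonneg (sq_nonneg κ) (h.mass_nonneg s x)]

lemma isTwoScaleBounded_deviation_add {φ : 𝒳 → ℝ} {x₀ : 𝒳} (hx₀ : x₀ ∈ B) (t : ℝ≥0) {e : ℝ}
    (he : IsTwoScaleBounded B e (deviation S x₀ φ t)) :
    IsTwoScaleBounded B (e / 2) (deviation S x₀ φ (2 * R + t)) := by
  have hκ := h.κ_le
  have he0 : 0 ≤ e := (abs_nonneg _).trans (he.2 x₀ hx₀)
  have hpos := h.mass_basin_pos hx₀ (2 * R + t)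
  set w : 𝒳 → ℝ := S (2 * R) *ᵥ deviation S x₀ φ t
  set ρ : 𝒳 → ℝ := fun x => mass S (2 * R + t) x / mass S (2 * R + t) x₀
  have hdev : ∀ x, deviation S x₀ φ (2 * R + t) x = w x - w x₀ * ρ x := fun x => by
    rw [h.deviation_add _ _ hpos.ne', Pi.sub_apply, Pi.smul_apply, smul_eq_mul, mul_div_assoc',
      div_mul_eq_mul_div]
  have hw : ∀ x, |w x| ≤ 1.1 * e := fun x => by
    nlinarith [h.abs_mulVec_two_mul_le he.2 he.1 x, h.κ_nonneg]
  refine ⟨fun x => ?_, fun x hx => ?_⟩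
  · have hρ : |ρ x| ≤ 1.1 := by
      rw [abs_of_nonneg (div_nonneg (h.mass_nonneg _ x) hpos.le), div_le_iff₀ hpos]
      nlinarith [h.mass_le_basin (2 * R + t) x hx₀]
    calc |deviation S x₀ φ (2 * R + t) x| ≤ |w x| + |w x₀| * |ρ x| := by
          rw [hdev, ← abs_mul]
          exact abs_sub _ _
      _ ≤ 1.1 * e + 1.1 * e * 1.1 := by
          gcongr
          exacts [hw x, hw x₀]
      _ ≤ 10 * (e / 2) := by linarith
  · calc |deviation S x₀ φ (2 * R + t) x| = |(w x - w x₀) + w x₀ * (1 - ρ x)| := by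
          rw [hdev]
          ring_nf
      _ ≤ 2 * κ * (10 * e) + 1.1 * e * (10 * κ) := by
          refine (abs_add_le _ _).trans
            (add_le_add (h.abs_mulVec_two_mul_sub_le he.1 hx hx₀) ?_)
          rw [abs_mul]
          gcongr
          exacts [hw x₀, h.abs_one_sub_mass_ratio_le _ hx hx₀]
      _ ≤ e / 2 := by nlinarith

lemma abs_deviation_le {φ : 𝒳 → ℝ} (hφ : ∀ y, |φ y| ≤ 1) {x₀ : 𝒳} (hx₀ : x₀ ∈ B) (n : ℕ)
    {t : ℝ≥0} (ht : n * (2 * R) ≤ t) (x : 𝒳) :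
    |deviation S x₀ φ t x| ≤ 20 * (1 / 2) ^ n := by
  suffices IsTwoScaleBounded B (2 * (1 / 2) ^ n) (deviation S x₀ φ t) from
    (this.1 x).trans_eq (by ring)
  obtain ⟨u, rfl⟩ := exists_add_of_le ht
  clear ht
  induction n with
  | zero =>
    have hdev := h.abs_deviation_le_two u hφ (h.mass_basin_pos hx₀ u)
    simp only [Nat.cast_zero, zero_mul, zero_add, pow_zero, mul_one]
    exact ⟨fun x => (hdev x).trans (by norm_num), fun x _ => hdev x⟩
  | succ n ih =>
    rw [show ((n + 1 : ℕ) : ℝ≥0) * (2 * R) + u = 2 * R + (n * (2 * R) + u) by push_cast; ring,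
      show (2 : ℝ) * (1 / 2) ^ (n + 1) = 2 * (1 / 2) ^ n / 2 by ring]
    exact h.isTwoScaleBounded_deviation_add hx₀ _ ih

lemma abs_mean_sub_normalizedMean_le {φ : 𝒳 → ℝ} (hφ : ∀ y, |φ y| ≤ 1) {x₀ : 𝒳} (hx₀ : x₀ ∈ B)
    {ν : 𝒳 → ℝ} (hν : 0 ≤ ν) (hν' : 0 < ∑ x, ν x) {n : ℕ} {t : ℝ≥0} (ht : n * (2 * R) ≤ t)
    {c : ℝ} (hc : 0 < c) (hmass : c * (9 / 10) ^ n * ∑ x, ν x ≤ ν ⬝ᵥ mass S t) :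
    |ν ⬝ᵥ (S t *ᵥ φ) / ν ⬝ᵥ mass S t - normalizedMean S x₀ φ t| ≤ 20 / c * (5 / 9) ^ n := by
  have hpos : 0 < ν ⬝ᵥ mass S t := lt_of_lt_of_le (by positivity) hmass
  have hdev : ν ⬝ᵥ (S t *ᵥ φ) / ν ⬝ᵥ mass S t - normalizedMean S x₀ φ t =
      ν ⬝ᵥ deviation S x₀ φ t / ν ⬝ᵥ mass S t := by
    rw [deviation, dotProduct_sub, dotProduct_smul, smul_eq_mul, sub_div,
      mul_div_cancel_right₀ _ hpos.ne']
  rw [hdev, abs_div, abs_of_pos hpos, div_le_iff₀ hpos]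
  calc |ν ⬝ᵥ deviation S x₀ φ t| ≤ (∑ x, |ν x|) * (20 * (1 / 2) ^ n) :=
        abs_dotProduct_le_sum_abs_mul (h.abs_deviation_le hφ hx₀ n ht)
    _ = 20 / c * (5 / 9) ^ n * (c * (9 / 10) ^ n * ∑ x, ν x) := by
        have hpow : (1 / 2 : ℝ) ^ n = (5 / 9) ^ n * (9 / 10) ^ n := by
          rw [← mul_pow]
          norm_num
        simp only [hpow, abs_of_nonneg (hν _)]
        field_simp
    _ ≤ 20 / c * (5 / 9) ^ n * ν ⬝ᵥ mass S t := by gcongr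

lemma floor_mul_le (t : ℝ≥0) : (⌊t / (2 * R)⌋₊ : ℝ≥0) * (2 * R) ≤ t := by
  rw [← le_div_iff₀ (mul_pos two_pos h.R_pos)]
  exact Nat.floor_le zero_le

lemma mass_add_ge_floor (s t : ℝ≥0) (x : 𝒳) {b : 𝒳} (hb : b ∈ B) :
    9 / 20 * (9 / 10) ^ ⌊t / (2 * R)⌋₊ * mass S s x ≤ mass S (s + t) b := by
  set n := ⌊t / (2 * R)⌋₊
  have ht : t ≤ ((2 * (n + 1) : ℕ) : ℝ≥0) * R := by
    have hlt := (Nat.lt_floor_add_one (t / (2 * R))).le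
    rw [div_le_iff₀ (mul_pos two_pos h.R_pos)] at hlt
    exact hlt.trans_eq (by push_cast; ring)
  have hpow : (9 / 10 : ℝ) ^ (n + 1) ≤ (1 - 2 * κ) ^ (2 * (n + 1)) := by
    rw [pow_mul]
    refine pow_le_pow_left₀ (by norm_num) ?_ _
    nlinarith [h.κ_nonneg, h.κ_le]
  have hbound := (mul_le_mul_of_nonneg_right hpow (h.mass_nonneg s x)).trans
    (h.mass_add_ge s x _ ht hb)
  rw [pow_succ] at hbound
  linarith

lemma tendsto_pow_floor (c : ℝ) :
    Tendsto (fun t : ℝ≥0 => c * (5 / 9 : ℝ) ^ ⌊t / (2 * R)⌋₊) atTop (𝓝 0) := by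
  have hfloor : Tendsto (fun t : ℝ≥0 => ⌊t / (2 * R)⌋₊) atTop atTop :=
    tendsto_nat_floor_atTop.comp (tendsto_id.atTop_div_const (mul_pos two_pos h.R_pos))
  simpa using ((tendsto_pow_atTop_nhds_zero_of_lt_one (r := (5 / 9 : ℝ)) (by norm_num)
    (by norm_num)).comp hfloor).const_mul c

lemma exists_tendsto_normalizedMean {φ : 𝒳 → ℝ} (hφ : ∀ y, |φ y| ≤ 1) {x₀ : 𝒳} (hx₀ : x₀ ∈ B) :
    ∃ l, Tendsto (normalizedMean S x₀ φ) atTop (𝓝 l) := by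
  have hclose (s t : ℝ≥0) : |normalizedMean S x₀ φ (s + t) - normalizedMean S x₀ φ t| ≤
      20 / (9 / 20) * (5 / 9) ^ ⌊t / (2 * R)⌋₊ := by
    rw [normalizedMean, h.mulVec_add, h.mass_add]
    refine h.abs_mean_sub_normalizedMean_le hφ hx₀ (h.nonneg s x₀) ?_ (h.floor_mul_le t)
      (by norm_num) ?_ <;> rw [sum_eq_mass]
    · exact h.mass_basin_pos hx₀ s
    · exact (h.mass_add_ge_floor s t x₀ hx₀).trans_eq (by rw [h.mass_add]; rfl)
  refine cauchySeq_tendsto_of_complete (Metric.cauchySeq_iff'.mpr fun ε hε => ?_)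
  obtain ⟨N, hN⟩ := ((h.tendsto_pow_floor _).eventually (gt_mem_nhds hε)).exists
  refine ⟨N, fun t ht => ?_⟩
  obtain ⟨s, rfl⟩ := exists_add_of_le ht
  rw [Real.dist_eq, add_comm]
  exact (hclose s N).trans_lt hN

lemma tendsto_mean {φ : 𝒳 → ℝ} (hφ : ∀ y, |φ y| ≤ 1) {x₀ : 𝒳} (hx₀ : x₀ ∈ B) {l : ℝ}
    (hl : Tendsto (normalizedMean S x₀ φ) atTop (𝓝 l)) {ν : 𝒳 → ℝ} (hν : 0 ≤ ν)
    (hν1 : ∑ x, ν x = 1) {c : ℝ} (hc : 0 < c) (hmass : ∀ t, c * mass S t x₀ ≤ ν ⬝ᵥ mass S t) :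
    Tendsto (fun t => ν ⬝ᵥ (S t *ᵥ φ) / ν ⬝ᵥ mass S t) atTop (𝓝 l) := by
  suffices Tendsto (fun t => ν ⬝ᵥ (S t *ᵥ φ) / ν ⬝ᵥ mass S t - normalizedMean S x₀ φ t) atTop
      (𝓝 0) by simpa using this.add hl
  refine squeeze_zero_norm (fun t => ?_) (h.tendsto_pow_floor (20 / (c * (2 / 5))))
  refine h.abs_mean_sub_normalizedMean_le hφ hx₀ hν (hν1.symm ▸ one_pos) (h.floor_mul_le t)
    (by positivity) ?_
  rw [hν1, mul_one, mul_assoc]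
  refine le_trans (mul_le_mul_of_nonneg_left ?_ hc.le) (hmass t)
  have hfloor := h.mass_add_ge_floor 0 t x₀ hx₀
  have hstart := h.mass_basin_ge (s := 0) zero_le hx₀
  rw [zero_add] at hfloor
  have hpow : (0 : ℝ) ≤ (9 / 10) ^ ⌊t / (2 * R)⌋₊ := by positivity
  nlinarith [h.κ_le]

lemma decay_ge {μ : 𝒳 → ℝ} (hμ : IsEigenLaw S μ) {x₀ : 𝒳} (hx₀ : x₀ ∈ B)
    (hlim : ∀ y, Tendsto (fun t => S t x₀ y / mass S t x₀) atTop (𝓝 (μ y))) :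
    1 - 2 * κ ≤ decay S μ R := by
  have hκ : 0 < 1 - 2 * κ := by linarith [h.κ_le]
  have hpow (n : ℕ) : (1 - 2 * κ) ^ n ≤ 2 * decay S μ (n * R) := by
    refine ge_of_tendsto' ((h.tendsto_mass_ratio hlim (n * R)).const_mul 2) fun t => ?_
    rw [← mul_div_assoc, le_div_iff₀ (h.mass_basin_pos hx₀ t)]
    exact h.mass_add_ge t x₀ n le_rfl hx₀
  by_contra! hlt
  obtain ⟨n, hn⟩ := exists_pow_lt_of_lt_one (show (0 : ℝ) < 1 / 2 by norm_num)
    ((div_lt_one hκ).mpr hlt)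
  have hle := pow_le_pow_of_le_one (div_nonneg (hμ.decay_nonneg h.toIsSubMarkovSemigroup R) hκ.le)
    ((div_lt_one hκ).mpr hlt).le (Nat.le_succ n)
  have hge : 1 / 2 ≤ (decay S μ R / (1 - 2 * κ)) ^ (n + 1) := by
    rw [div_pow, le_div_iff₀ (pow_pos hκ _), ← hμ.decay_nat_mul h.toIsSubMarkovSemigroup]
    linarith [hpow (n + 1)]
  exact (hge.trans hle).not_gt hn

theorem exists_isEigenLaw : ∃ μ, IsEigenLaw S μ ∧ 1 - 2 * κ ≤ decay S μ R ∧
    ∀ b ∈ B, IsYaglomLimit S b μ := by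
  classical
  obtain ⟨x₀, hx₀⟩ := h.nonempty
  have hsingle (y z : 𝒳) : |(Pi.single y 1 : 𝒳 → ℝ) z| ≤ 1 := by
    rw [Pi.single_apply]
    split_ifs <;> simp
  choose μ hμ using fun y => h.exists_tendsto_normalizedMean (hsingle y) hx₀
  have hlim (y : 𝒳) : Tendsto (fun t => S t x₀ y / mass S t x₀) atTop (𝓝 (μ y)) :=
    (hμ y).congr fun t => by rw [normalizedMean, mulVec_single_one]; rfl
  have heigen := h.isEigenLaw_of_tendsto (h.mass_basin_pos hx₀) hlim
  refine ⟨μ, heigen, h.decay_ge heigen hx₀ hlim, fun b hb ν hν hν1 c hc hmass => ?_⟩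
  refine tendsto_pi_nhds.mpr fun y => ?_
  have htendsto := h.tendsto_mean (hsingle y) hx₀ (hμ y) hν hν1 (half_pos hc) fun t =>
    le_trans (by nlinarith [h.mass_le_two_mul_basin t x₀ hb]) (hmass t)
  exact htendsto.congr fun t => by rw [mulVec_single_one]; rfl

end IsReturnKernel

end YaglomLimit

section SurvivalEstimates

variable {𝒳 : Type*} [Fintype 𝒳] {S : ℝ≥0 → Matrix 𝒳 𝒳 ℝ} {B : Set 𝒳} {q : 𝒳 → ℝ} {R : ℝ≥0}
  {κ : ℝ} {μ : 𝒳 → ℝ}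

namespace IsReturnKernel

variable (h : IsReturnKernel S B q R κ) (hμ : IsEigenLaw S μ)
include h hμ

variable (hR : 1 - 2 * κ ≤ decay S μ R)
include hR

lemma decay_le_mul_decay_add (s : ℝ≥0) : decay S μ s ≤ (1 + 3 * κ) * decay S μ (s + R) := by
  have hstep : 1 ≤ (1 + 3 * κ) * decay S μ R := by nlinarith [h.κ_nonneg, h.κ_le]
  rw [hμ.decay_add h.toIsSubMarkovSemigroup, mul_left_comm]
  exact le_mul_of_one_le_right (hμ.decay_nonneg h.toIsSubMarkovSemigroup s) hstep

lemma mass_add_le_decay (s : ℝ≥0) (x : 𝒳) :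
    mass S (s + R) x ≤ (1 + 20 * κ) * decay S μ (s + R) := by
  have hκ := h.κ_nonneg
  have hκ' := h.κ_le
  set M := mass S (s + R) x / (1 + 10 * κ)
  have hden : 0 < 1 + 10 * κ := by linarith
  have hM0 : 0 ≤ M := div_nonneg (h.mass_nonneg _ x) hden.le
  have hMB : ∀ b ∈ B, M ≤ mass S (s + R) b := fun b hb => by
    rw [div_le_iff₀ hden, mul_comm]
    exact h.mass_le_basin _ x hb
  have hlow : (decay S μ R - κ * 1) * M ≤ decay S μ (s + R) := by
    rw [← hμ.sum_one]
    exact h.dotProduct_mass_ge hμ.nonneg hM0 hMB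
  calc mass S (s + R) x = (1 + 10 * κ) * M := (mul_div_cancel₀ _ hden.ne').symm
    _ ≤ (1 + 20 * κ) * (decay S μ R - κ * 1) * M := by
        gcongr
        nlinarith
    _ ≤ (1 + 20 * κ) * decay S μ (s + R) := by
        rw [mul_assoc]
        gcongr

lemma mass_le_decay (s : ℝ≥0) (x : 𝒳) : mass S s x ≤ (1 + 20 * κ) * decay S μ s := by
  rcases le_total s R with hs | hs
  · nlinarith [h.κ_nonneg, h.κ_le, h.mass_le s x, hμ.decay_anti h.toIsSubMarkovSemigroup hs]
  · obtain ⟨u, rfl⟩ := exists_add_of_le hs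
    rw [add_comm]
    exact h.mass_add_le_decay hμ hR u x

lemma abs_basin_sub_decay_le (s : ℝ≥0) {b : 𝒳} (hb : b ∈ B) :
    |mass S s b - decay S μ s| ≤ 20 * κ * decay S μ s := by
  have hκ := h.κ_nonneg
  have hup := h.mass_le_decay hμ hR s b
  have hlow : decay S μ s ≤ (1 + 10 * κ) * mass S s b :=
    dotProduct_le_of_forall_le hμ.nonneg hμ.sum_one fun x => h.mass_le_basin s x hb
  rw [abs_le]
  constructor <;> nlinarith [h.κ_le, h.mass_nonneg s b, hμ.decay_nonneg h.toIsSubMarkovSemigroup s]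

lemma decay_pos (s : ℝ≥0) : 0 < decay S μ s := by
  obtain ⟨b, hb⟩ := h.nonempty
  refine pos_of_mul_pos_right (a := 1 + 20 * κ) ?_ (by linarith [h.κ_nonneg])
  exact (h.mass_basin_pos hb s).trans_le (h.mass_le_decay hμ hR s b)

lemma abs_average_sub_decay_le (s : ℝ≥0) {ν : 𝒳 → ℝ} (hν : 0 ≤ ν) (hν1 : ∑ x, ν x = 1)
    (hB : 1 - κ ≤ ν ⬝ᵥ B.indicator 1) :
    |ν ⬝ᵥ mass S s - decay S μ s| ≤ 100 * κ * decay S μ s := by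
  have hκ := h.κ_nonneg
  have hκ' := h.κ_le
  have hE := hμ.decay_nonneg h.toIsSubMarkovSemigroup s
  have hup : ν ⬝ᵥ mass S s ≤ (1 + 20 * κ) * decay S μ s :=
    dotProduct_le_of_forall_le hν hν1 (h.mass_le_decay hμ hR s)
  have hlow : (1 - κ) * ((1 - 20 * κ) * decay S μ s) ≤ ν ⬝ᵥ mass S s := by
    refine (mul_le_mul_of_nonneg_right hB (mul_nonneg (by linarith) hE)).trans ?_
    rw [dotProduct, Finset.sum_mul]
    refine Finset.sum_le_sum fun x _ => ?_
    by_cases hx : x ∈ B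
    · rw [Set.indicator_of_mem hx, Pi.one_apply, mul_one]
      refine mul_le_mul_of_nonneg_left ?_ (hν x)
      linarith [(abs_le.mp (h.abs_basin_sub_decay_le hμ hR s hx)).1]
    · rw [Set.indicator_of_notMem hx, mul_zero, zero_mul]
      exact mul_nonneg (hν x) (h.mass_nonneg s x)
  have hκE := mul_nonneg hκ hE
  rw [abs_le]
  constructor <;> nlinarith [mul_nonneg hκ hκE]

lemma mass_add_le_mul_decay (s : ℝ≥0) (x : 𝒳) {p : ℝ} (hp : q x * (1 - κ) ≤ p) :
    mass S (s + R) x ≤ (p + 50 * κ) * decay S μ (s + R) := by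
  have hκ := h.κ_nonneg
  have hκ' := h.κ_le
  have hqκ : q x * κ ≤ κ := mul_le_of_le_one_left hκ (h.q_le x)
  have hup := h.upper s x _ _ (h.mass_le_decay hμ hR s)
    (fun b _ => h.mass_le_decay hμ hR s b)
  calc mass S (s + R) x ≤ (κ + q x) * (1 + 20 * κ) * decay S μ s := hup.trans_eq (by ring)
    _ ≤ (q x + 22 * κ) * decay S μ s := by
        refine mul_le_mul_of_nonneg_right ?_ (hμ.decay_nonneg h.toIsSubMarkovSemigroup s)
        nlinarith
    _ ≤ (q x + 22 * κ) * ((1 + 3 * κ) * decay S μ (s + R)) := by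
        refine mul_le_mul_of_nonneg_left (h.decay_le_mul_decay_add hμ hR s) ?_
        linarith [h.q_nonneg x]
    _ = (q x + 22 * κ) * (1 + 3 * κ) * decay S μ (s + R) := by ring
    _ ≤ (p + 50 * κ) * decay S μ (s + R) := by
        refine mul_le_mul_of_nonneg_right ?_ (hμ.decay_nonneg h.toIsSubMarkovSemigroup _)
        nlinarith

lemma mul_decay_le_mass_add (s : ℝ≥0) (x : 𝒳) {p : ℝ} (hp : p ≤ q x) :
    (p - 20 * κ) * decay S μ (s + R) ≤ mass S (s + R) x := by
  have hlow := h.lower s x ((1 - 20 * κ) * decay S μ (s + R)) fun b hb => by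
    linarith [(abs_le.mp (h.abs_basin_sub_decay_le hμ hR (s + R) hb)).1]
  refine le_trans ?_ hlow
  rw [← mul_assoc]
  refine mul_le_mul_of_nonneg_right ?_ (hμ.decay_nonneg h.toIsSubMarkovSemigroup _)
  nlinarith [mul_le_of_le_one_left h.κ_nonneg (h.q_le x)]

lemma abs_mass_sub_mul_decay_le (s : ℝ≥0) (x : 𝒳) {p : ℝ} (hp : q x * (1 - κ) ≤ p)
    (hp' : p ≤ q x) :
    |mass S (s + R) x - p * decay S μ (s + R)| ≤ 100 * κ * decay S μ (s + R) := by
  have hκE := mul_nonneg h.κ_nonneg (hμ.decay_nonneg h.toIsSubMarkovSemigroup (s + R))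
  rw [abs_le]
  constructor <;>
    linarith [h.mass_add_le_mul_decay hμ hR s x hp, h.mul_decay_le_mass_add hμ hR s x hp']

end IsReturnKernel

end SurvivalEstimates

section SubRates

attribute [local instance] Matrix.linftyOpNormedRing Matrix.linftyOpNormedAlgebra

variable {𝒳 : Type*} [Fintype 𝒳] [DecidableEq 𝒳]

lemma one_add_apply_le_exp_apply {M : Matrix 𝒳 𝒳 ℝ} (hM : ∀ x y, 0 ≤ M x y) (x y : 𝒳) :
    (1 + M) x y ≤ NormedSpace.exp M x y := by
  have hpow : ∀ n x y, 0 ≤ (M ^ n) x y := by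
    intro n
    induction n with
    | zero => exact fun x y => by rw [pow_zero, one_apply]; split_ifs <;> simp
    | succ n ih =>
      exact fun x y => by
        rw [pow_succ, mul_apply]
        exact Finset.sum_nonneg fun z _ => mul_nonneg (ih x z) (hM z y)
  have hsum : HasSum (fun n : ℕ => ((n.factorial : ℝ)⁻¹ • M ^ n) x y)
      (NormedSpace.exp M x y) :=
    (NormedSpace.exp_series_hasSum_exp' (𝕂 := ℝ) M).mapL
      (entryLinearMap ℝ ℝ x y).toContinuousLinearMap
  calc (1 + M) x y = ∑ n ∈ Finset.range 2, ((n.factorial : ℝ)⁻¹ • M ^ n) x y := by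
        simp [Finset.sum_range_succ]
    _ ≤ NormedSpace.exp M x y := sum_le_hasSum _
        (fun n _ => mul_nonneg (by positivity) (hpow n x y)) hsum

lemma exp_smul_eq_smul_exp_smul_add (L : Matrix 𝒳 𝒳 ℝ) (t c : ℝ) :
    NormedSpace.exp (t • L) =
      Real.exp (-(t * c)) • NormedSpace.exp (t • (L + c • (1 : Matrix 𝒳 𝒳 ℝ))) := by
  have hcomm : Commute (-(t * c) • (1 : Matrix 𝒳 𝒳 ℝ)) (t • (L + c • (1 : Matrix 𝒳 𝒳 ℝ))) :=
    (Commute.one_left _).smul_left _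
  have hscalar : NormedSpace.exp (-(t * c) • (1 : Matrix 𝒳 𝒳 ℝ)) = Real.exp (-(t * c)) • 1 := by
    rw [← Algebra.algebraMap_eq_smul_one, ← Algebra.algebraMap_eq_smul_one, Real.exp_eq_exp_ℝ]
    exact (NormedSpace.algebraMap_exp_comm (𝔸 := Matrix 𝒳 𝒳 ℝ) _).symm
  rw [← one_mul (NormedSpace.exp (t • (L + _))), ← smul_mul_assoc, ← hscalar,
    ← exp_add_of_commute _ _ hcomm]
  congr 1
  module

section OffDiagNonneg

variable {L : Matrix 𝒳 𝒳 ℝ} (hL : ∀ x y, x ≠ y → 0 ≤ L x y)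
include hL

/- Adding a large multiple of the identity makes `L` entrywise non-negative and only multiplies
the exponential by a positive constant. -/
lemma exists_pos_mul_le_exp_smul {t : ℝ} (ht : 0 ≤ t) :
    ∃ ε : ℝ, 0 < ε ∧ (∀ x, ε ≤ NormedSpace.exp (t • L) x x) ∧
      ∀ x y, x ≠ y → ε * (t * L x y) ≤ NormedSpace.exp (t • L) x y := by
  set c : ℝ := ∑ x, |L x x|
  have hdiag : ∀ x, 0 ≤ L x x + c := fun x => by
    linarith [neg_abs_le (L x x),
      Finset.single_le_sum (fun z _ => abs_nonneg (L z z)) (Finset.mem_univ x)]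
  have hshift : ∀ x y, 0 ≤ (t • (L + c • (1 : Matrix 𝒳 𝒳 ℝ))) x y := fun x y => by
    refine mul_nonneg ht ?_
    rcases eq_or_ne x y with rfl | hxy
    · simpa using hdiag x
    · simpa [one_apply_ne hxy] using hL x y hxy
  refine ⟨Real.exp (-(t * c)), Real.exp_pos _, fun x => ?_, fun x y hxy => ?_⟩ <;>
    rw [exp_smul_eq_smul_exp_smul_add L t c, Matrix.smul_apply, smul_eq_mul]
  · refine le_mul_of_one_le_right (Real.exp_pos _).le ?_
    refine le_trans ?_ (one_add_apply_le_exp_apply hshift x x)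
    rw [Matrix.add_apply, one_apply_eq]
    exact le_add_of_nonneg_right (hshift x x)
  · refine mul_le_mul_of_nonneg_left (le_trans (le_of_eq ?_)
      (one_add_apply_le_exp_apply hshift x y)) (Real.exp_pos _).le
    simp [one_apply_ne hxy]

lemma exp_smul_nonneg {t : ℝ} (ht : 0 ≤ t) (x y : 𝒳) : 0 ≤ NormedSpace.exp (t • L) x y := by
  obtain ⟨ε, hε, hdiag, hoff⟩ := exists_pos_mul_le_exp_smul hL ht
  rcases eq_or_ne x y with rfl | hxy
  · exact hε.le.trans (hdiag x)
  · exact (mul_nonneg hε.le (mul_nonneg ht (hL x y hxy))).trans (hoff x y hxy)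

lemma exp_smul_pos_of_reflTransGen {x y : 𝒳}
    (hxy : Relation.ReflTransGen (fun a b => 0 < L a b) x y) {t : ℝ} (ht : 0 < t) :
    0 < NormedSpace.exp (t • L) x y := by
  induction hxy using Relation.ReflTransGen.head_induction_on generalizing t with
  | refl =>
    obtain ⟨ε, hε, hdiag, -⟩ := exists_pos_mul_le_exp_smul hL ht.le
    exact hε.trans_le (hdiag y)
  | @head a b hab _ ih =>
    obtain ⟨ε, hε, hdiag, hoff⟩ := exists_pos_mul_le_exp_smul hL (half_pos ht).le
    have hstep : 0 < NormedSpace.exp ((t / 2) • L) a b := by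
      rcases eq_or_ne a b with rfl | hne
      · exact hε.trans_le (hdiag a)
      · exact (mul_pos hε (mul_pos (half_pos ht) hab)).trans_le (hoff a b hne)
    have hsplit : t • L = (t / 2) • L + (t / 2) • L := by rw [← add_smul, add_halves]
    rw [hsplit, exp_add_of_commute _ _ (Commute.refl _), mul_apply]
    exact Finset.sum_pos' (fun z _ => mul_nonneg (exp_smul_nonneg hL (half_pos ht).le a z)
      (exp_smul_nonneg hL (half_pos ht).le z y))
      ⟨b, Finset.mem_univ b, mul_pos hstep (ih (half_pos ht))⟩

end OffDiagNonneg

lemma hasDerivAt_exp_smul (L : Matrix 𝒳 𝒳 ℝ) (t : ℝ) (x y : 𝒳) :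
    HasDerivAt (fun t : ℝ => NormedSpace.exp (t • L) x y) ((NormedSpace.exp (t • L) * L) x y) t :=
  (entryLinearMap ℝ ℝ x y).toContinuousLinearMap.hasFDerivAt.comp_hasDerivAt t
    (hasDerivAt_exp_smul_const (𝕂 := ℝ) L t)

lemma hasDerivAt_exp_smul_mulVec (L : Matrix 𝒳 𝒳 ℝ) (φ : 𝒳 → ℝ) (t : ℝ) (x : 𝒳) :
    HasDerivAt (fun t : ℝ => (NormedSpace.exp (t • L) *ᵥ φ) x)
      ((NormedSpace.exp (t • L) *ᵥ (L *ᵥ φ)) x) t := by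
  rw [mulVec_mulVec]
  exact HasDerivAt.fun_sum fun y _ => (hasDerivAt_exp_smul L t x y).mul_const (φ y)

lemma exp_smul_mulVec_of_mulVec_eq_zero {L : Matrix 𝒳 𝒳 ℝ} {φ : 𝒳 → ℝ} (hφ : L *ᵥ φ = 0) (t : ℝ) :
    NormedSpace.exp (t • L) *ᵥ φ = φ := by
  ext x
  have hderiv := hasDerivAt_exp_smul_mulVec L φ
  simp only [hφ, mulVec_zero, Pi.zero_apply] at hderiv
  rw [is_const_of_deriv_eq_zero (fun t => (hderiv t x).differentiableAt)
    (fun t => (hderiv t x).deriv) t 0, zero_smul, NormedSpace.exp_zero, one_mulVec]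

lemma exp_smul_mulVec_one_le_one {L : Matrix 𝒳 𝒳 ℝ} (hL : ∀ x y, x ≠ y → 0 ≤ L x y)
    (hL1 : ∀ x, (L *ᵥ 1) x ≤ 0) {t : ℝ} (ht : 0 ≤ t) (x : 𝒳) :
    (NormedSpace.exp (t • L) *ᵥ 1) x ≤ 1 := by
  have hderiv := fun t => hasDerivAt_exp_smul_mulVec L 1 t x
  have hanti : AntitoneOn (fun t : ℝ => (NormedSpace.exp (t • L) *ᵥ 1) x) (Set.Ici 0) := by
    refine antitoneOn_of_deriv_nonpos (convex_Ici 0)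
      (fun s _ => (hderiv s).continuousAt.continuousWithinAt)
      (fun s _ => (hderiv s).differentiableAt.differentiableWithinAt) fun s hs => ?_
    rw [interior_Ici] at hs
    rw [(hderiv s).deriv]
    exact Finset.sum_nonpos fun y _ =>
      mul_nonpos_of_nonneg_of_nonpos (exp_smul_nonneg hL (le_of_lt hs) x y) (hL1 y)
  simpa using hanti Set.self_mem_Ici ht ht

end SubRates

section KilledSemigroup

attribute [local instance] Matrix.linftyOpNormedRing Matrix.linftyOpNormedAlgebra

lemma IsRateMatrix.mulVec_one {𝒳 : Type*} [Fintype 𝒳] {Q : Matrix 𝒳 𝒳 ℝ} (hQ : IsRateMatrix Q) :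
    Q *ᵥ 1 = 0 := by
  ext x
  exact (dotProduct_one _).trans (hQ.row_sum x)

variable {𝒳 : Type*} [DecidableEq 𝒳]

/-- The diagonal projection onto the states of `B`. -/
def proj (B : Set 𝒳) : Matrix 𝒳 𝒳 ℝ := diagonal (B.indicator 1)

variable [Fintype 𝒳]

/-- The rates of the chain killed on `G`. -/
def killedRates (Q : Matrix 𝒳 𝒳 ℝ) (G : Set 𝒳) : Matrix 𝒳 𝒳 ℝ := proj Gᶜ * Q * proj Gᶜ

/-- The transition kernel of the chain killed on `G`, as a function of a real time so that it can be
differentiated. The projection removes the paths starting in `G`, which are dead at time `0`. -/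
def killedKernel (Q : Matrix 𝒳 𝒳 ℝ) (G : Set 𝒳) (t : ℝ) : Matrix 𝒳 𝒳 ℝ :=
  proj Gᶜ * NormedSpace.exp (t • killedRates Q G)

/-- The transition semigroup of the chain killed on `G`. -/
def killedSemigroup (Q : Matrix 𝒳 𝒳 ℝ) (G : Set 𝒳) (t : ℝ≥0) : Matrix 𝒳 𝒳 ℝ :=
  killedKernel Q G t

lemma proj_mulVec (B : Set 𝒳) (φ : 𝒳 → ℝ) : proj B *ᵥ φ = B.indicator φ := by
  ext x
  rw [proj, mulVec_diagonal]
  by_cases hx : x ∈ B <;> simp [hx]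

lemma proj_mul_proj (B C : Set 𝒳) : proj B * proj C = proj (B ∩ C) := by
  rw [proj, proj, diagonal_mul_diagonal, proj, Set.inter_indicator_one]
  rfl

variable (Q : Matrix 𝒳 𝒳 ℝ) (G : Set 𝒳)

lemma proj_mul_killedRates : proj Gᶜ * killedRates Q G = killedRates Q G := by
  rw [killedRates, mul_assoc, ← mul_assoc, proj_mul_proj, Set.inter_self]

lemma killedRates_mul_proj : killedRates Q G * proj Gᶜ = killedRates Q G := by
  rw [killedRates, mul_assoc, proj_mul_proj, Set.inter_self]

lemma killedKernel_eq_exp_mul (t : ℝ) :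
    killedKernel Q G t = NormedSpace.exp (t • killedRates Q G) * proj Gᶜ := by
  have hcomm : Commute (proj Gᶜ) (killedRates Q G) :=
    (proj_mul_killedRates Q G).trans (killedRates_mul_proj Q G).symm
  exact (hcomm.smul_right t).exp_right

lemma proj_mul_killedKernel (t : ℝ) : proj Gᶜ * killedKernel Q G t = killedKernel Q G t := by
  rw [killedKernel, ← mul_assoc, proj_mul_proj, Set.inter_self]

lemma killedKernel_mul_proj (t : ℝ) : killedKernel Q G t * proj Gᶜ = killedKernel Q G t := by
  rw [killedKernel_eq_exp_mul, mul_assoc, proj_mul_proj, Set.inter_self]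

lemma killedKernel_zero : killedKernel Q G 0 = proj Gᶜ := by
  rw [killedKernel, zero_smul, NormedSpace.exp_zero, mul_one]

lemma killedKernel_add (s t : ℝ) :
    killedKernel Q G (s + t) = killedKernel Q G s * killedKernel Q G t := by
  rw [killedKernel_eq_exp_mul Q G s, mul_assoc, proj_mul_killedKernel, killedKernel_eq_exp_mul,
    add_smul, exp_add_of_commute _ _ ((Commute.refl _).smul_left s |>.smul_right t),
    killedKernel_eq_exp_mul, mul_assoc]

lemma killedKernel_empty (t : ℝ) : killedKernel Q ∅ t = NormedSpace.exp (t • Q) := by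
  simp [killedKernel, killedRates, proj]

lemma hasDerivAt_killedKernel (t : ℝ) :
    HasDerivAt (killedKernel Q G) (killedKernel Q G t * killedRates Q G) t := by
  rw [killedKernel, mul_assoc]
  exact (hasDerivAt_exp_smul_const (𝕂 := ℝ) (killedRates Q G) t).const_mul (proj Gᶜ)

lemma continuous_killedKernel : Continuous (killedKernel Q G) :=
  continuous_iff_continuousAt.2 fun t => (hasDerivAt_killedKernel Q G t).continuousAt

lemma killedKernel_mul_killedRates_comm (t : ℝ) :
    killedRates Q G * killedKernel Q G t = killedKernel Q G t * killedRates Q G := by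
  have hcomm : Commute (killedRates Q G) (NormedSpace.exp (t • killedRates Q G)) :=
    ((Commute.refl _).smul_right t).exp_right
  rw [killedKernel, ← mul_assoc, killedRates_mul_proj, mul_assoc, ← hcomm.eq, ← mul_assoc,
    proj_mul_killedRates]

variable {Q G}

lemma killedRates_apply_of_notMem {x y : 𝒳} (hx : x ∉ G) (hy : y ∉ G) :
    killedRates Q G x y = Q x y := by
  simp [killedRates, proj, hx, hy]

lemma killedRates_nonneg (hQ : IsRateMatrix Q) (x y : 𝒳) (hxy : x ≠ y) :
    0 ≤ killedRates Q G x y := by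
  rw [killedRates, proj, mul_diagonal, diagonal_mul]
  exact mul_nonneg (mul_nonneg (Set.indicator_nonneg (fun _ _ => zero_le_one) x)
    (hQ.nonneg x y hxy)) (Set.indicator_nonneg (fun _ _ => zero_le_one) y)

lemma killedRates_mulVec_one_nonpos (hQ : IsRateMatrix Q) (x : 𝒳) :
    (killedRates Q G *ᵥ 1) x ≤ 0 := by
  rw [killedRates, ← mulVec_mulVec, ← mulVec_mulVec, proj_mulVec, proj_mulVec]
  refine Set.indicator_apply_le' (fun hx => ?_) fun _ => le_rfl
  refine le_of_le_of_eq ?_ (congrFun hQ.mulVec_one x)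
  refine Finset.sum_le_sum fun y _ => ?_
  by_cases hy : y ∈ G
  · simpa [hy] using hQ.nonneg x y (ne_of_mem_of_not_mem hy hx).symm
  · simp [hy]

lemma killedKernel_nonneg (hQ : IsRateMatrix Q) {t : ℝ} (ht : 0 ≤ t) (x y : 𝒳) :
    0 ≤ killedKernel Q G t x y := by
  rw [killedKernel, proj, diagonal_mul]
  exact mul_nonneg (Set.indicator_nonneg (fun _ _ => zero_le_one) x)
    (exp_smul_nonneg (killedRates_nonneg hQ) ht x y)

lemma killedKernel_apply_of_mem_left {x : 𝒳} (hx : x ∈ G) (t : ℝ) (y : 𝒳) :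
    killedKernel Q G t x y = 0 := by
  simp [killedKernel, proj, hx]

lemma killedKernel_apply_of_mem_right {y : 𝒳} (hy : y ∈ G) (t : ℝ) (x : 𝒳) :
    killedKernel Q G t x y = 0 := by
  rw [killedKernel_eq_exp_mul]
  simp [proj, hy]

lemma isSubMarkovSemigroup_killedSemigroup (hQ : IsRateMatrix Q) (G : Set 𝒳) :
    IsSubMarkovSemigroup (killedSemigroup Q G) where
  nonneg t := killedKernel_nonneg hQ t.2
  add s t := killedKernel_add Q G s t
  mass_le t x := by
    rw [mass, killedSemigroup, killedKernel, ← mulVec_mulVec, proj_mulVec]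
    exact Set.indicator_apply_le' (fun _ => exp_smul_mulVec_one_le_one (killedRates_nonneg hQ)
      (killedRates_mulVec_one_nonpos hQ) t.2 x) fun _ => zero_le_one

lemma killedSemigroup_empty : killedSemigroup Q ∅ = semigroup Q :=
  funext fun t => killedKernel_empty Q t

lemma semigroup_mulVec_one (hQ : IsRateMatrix Q) (t : ℝ≥0) : semigroup Q t *ᵥ 1 = 1 :=
  exp_smul_mulVec_of_mulVec_eq_zero hQ.mulVec_one t

lemma mass_killedSemigroup_of_mem {x : 𝒳} (hx : x ∈ G) (t : ℝ≥0) :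
    mass (killedSemigroup Q G) t x = 0 := by
  rw [← sum_eq_mass]
  exact Finset.sum_eq_zero fun y _ => killedKernel_apply_of_mem_left hx t y

lemma IsIrreducibleRate.semigroup_pos (hirr : IsIrreducibleRate Q) (hQ : IsRateMatrix Q) {t : ℝ≥0}
    (ht : 0 < t) (x y : 𝒳) : 0 < semigroup Q t x y :=
  exp_smul_pos_of_reflTransGen hQ.nonneg (hirr x y) ht

lemma IsIrreducibleOn.killedSemigroup_pos (hirr : IsIrreducibleOn Q Gᶜ) (hQ : IsRateMatrix Q)
    {t : ℝ≥0} (ht : 0 < t) {x y : 𝒳} (hx : x ∉ G) (hy : y ∉ G) :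
    0 < killedSemigroup Q G t x y := by
  have hpath : Relation.ReflTransGen (fun a b => 0 < killedRates Q G a b) x y := by
    refine (?_ : ∀ z, Relation.ReflTransGen (fun a b => 0 < Q a b ∧ b ∈ Gᶜ) x z →
      z ∉ G ∧ Relation.ReflTransGen (fun a b => 0 < killedRates Q G a b) x z) y
        (hirr x hx y hy) |>.2
    intro z hz
    induction hz with
    | refl => exact ⟨hx, .refl⟩
    | tail _ hstep ih =>
      exact ⟨hstep.2, ih.2.tail ((killedRates_apply_of_notMem ih.1 hstep.2).symm ▸ hstep.1)⟩
  rw [killedSemigroup, killedKernel, proj, diagonal_mul, Set.indicator_of_mem (by exact hx),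
    Pi.one_apply, one_mul]
  exact exp_smul_pos_of_reflTransGen (killedRates_nonneg hQ) hpath ht

end KilledSemigroup

section Reversal

attribute [local instance] Matrix.linftyOpNormedRing Matrix.linftyOpNormedAlgebra

variable {𝒳 : Type*} [Fintype 𝒳] {Q : Matrix 𝒳 𝒳 ℝ} {π : 𝒳 → ℝ}

lemma IsInvariant.pos (hπ : IsInvariant Q π) (hQ : IsRateMatrix Q) (hirr : IsIrreducibleRate Q)
    (x : 𝒳) : 0 < π x := by
  refine (hπ.nonneg x).lt_of_ne' fun hx => ?_
  have hstep : ∀ a b, 0 < Q a b → π b = 0 → π a = 0 := fun a b hab hb => by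
    have hterm : ∀ c ∈ Finset.univ, 0 ≤ π c * Q c b := fun c _ => by
      rcases eq_or_ne c b with rfl | hc
      · rw [hb, zero_mul]
      · exact mul_nonneg (hπ.nonneg c) (hQ.nonneg c b hc)
    exact (mul_eq_zero.mp ((Finset.sum_eq_zero_iff_of_nonneg hterm).mp (hπ.invariant b) a
      (Finset.mem_univ a))).resolve_right hab.ne'
  have hzero : ∀ y, π y = 0 := fun y => by
    induction hirr y x using Relation.ReflTransGen.head_induction_on with
    | refl => exact hx
    | head hab _ ih => exact hstep _ _ hab ih
  simpa [hzero] using hπ.sum_one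

lemma isRateMatrix_reversedRates (hQ : IsRateMatrix Q) (hπ : IsInvariant Q π) :
    IsRateMatrix (reversedRates Q π) where
  nonneg x y hxy := mul_nonneg (div_nonneg (hπ.nonneg y) (hπ.nonneg x)) (hQ.nonneg y x hxy.symm)
  row_sum x := by
    simp only [reversedRates, of_apply, div_mul_eq_mul_div, ← Finset.sum_div, hπ.invariant x,
      zero_div]

variable [DecidableEq 𝒳]

/- Reversal is conjugation by `diagonal π` followed by transposition, and both commute with the
exponential. -/
lemma killedSemigroup_reversedRates (hπ : ∀ x, 0 < π x) (G : Set 𝒳) (t : ℝ≥0) (x y : 𝒳) :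
    π x * killedSemigroup (reversedRates Q π) G t x y = π y * killedSemigroup Q G t y x := by
  have hrates : diagonal π * reversedRates Q π = Qᵀ * diagonal π := by
    ext a b
    rw [diagonal_mul, mul_diagonal, reversedRates, of_apply, transpose_apply]
    have := (hπ a).ne'
    field_simp
  have hproj : diagonal π * proj Gᶜ = proj Gᶜ * diagonal π := by
    rw [proj, diagonal_mul_diagonal, diagonal_mul_diagonal]
    simp only [mul_comm]
  have hkilled : SemiconjBy (diagonal π) (killedRates (reversedRates Q π) G)
      (killedRates Q G)ᵀ := by
    rw [SemiconjBy, killedRates, killedRates, transpose_mul, transpose_mul, proj,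
      diagonal_transpose, ← proj, ← mul_assoc, ← mul_assoc, hproj, mul_assoc (proj Gᶜ), hrates,
      mul_assoc, mul_assoc, hproj]
    simp only [mul_assoc]
  have hexp : diagonal π * NormedSpace.exp ((t : ℝ) • killedRates (reversedRates Q π) G) =
      (NormedSpace.exp ((t : ℝ) • killedRates Q G))ᵀ * diagonal π := by
    rw [← exp_transpose, transpose_smul]
    exact SemiconjBy.exp_right (hkilled.smul_right _)
  have hkernel : diagonal π * killedSemigroup (reversedRates Q π) G t =
      (killedSemigroup Q G t)ᵀ * diagonal π := by
    rw [killedSemigroup, killedKernel, ← mul_assoc, hproj, mul_assoc, hexp, killedSemigroup,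
      killedKernel_eq_exp_mul, transpose_mul, proj, diagonal_transpose, mul_assoc]
  have hentry := congrFun₂ hkernel x y
  rwa [diagonal_mul, mul_diagonal, transpose_apply, mul_comm _ (π y)] at hentry

lemma vecMul_semigroup (hQ : IsRateMatrix Q) (hπ : IsInvariant Q π) (hpos : ∀ x, 0 < π x)
    (t : ℝ≥0) : π ᵥ* semigroup Q t = π := by
  ext y
  calc ∑ x, π x * semigroup Q t x y = ∑ x, π y * semigroup (reversedRates Q π) t y x := by
        simp only [← killedSemigroup_empty, killedSemigroup_reversedRates hpos]
    _ = π y * (semigroup (reversedRates Q π) t *ᵥ 1) y := by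
        rw [← Finset.mul_sum, mulVec, dotProduct_one]
    _ = π y := by
        rw [semigroup_mulVec_one (isRateMatrix_reversedRates hQ hπ), Pi.one_apply, mul_one]

end Reversal

section Entrance

attribute [local instance] Matrix.linftyOpNormedRing Matrix.linftyOpNormedAlgebra

variable {𝒳 : Type*} [Fintype 𝒳] [DecidableEq 𝒳]

/-- The density in time of the entrance into `B` of the chain which is killed on `K`: the `(x, b)`
entry is the rate at which the chain started at `x` jumps into `b ∈ B` at time `t`. -/
def entranceDensity (Q : Matrix 𝒳 𝒳 ℝ) (K B : Set 𝒳) (t : ℝ) : Matrix 𝒳 𝒳 ℝ :=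
  killedKernel Q K t * Q * proj B

/-- The probability, as a function of the starting point, that the chain enters `K` before time `R`
and does so through `B ⊆ K`. -/
def entrance (Q : Matrix 𝒳 𝒳 ℝ) (K B : Set 𝒳) (R : ℝ) (x : 𝒳) : ℝ :=
  B.indicator 1 x + ∫ t in 0..R, (entranceDensity Q K B t *ᵥ 1) x

variable {Q : Matrix 𝒳 𝒳 ℝ} {G K B : Set 𝒳}

lemma continuous_entranceDensity_mulVec {φ : ℝ → 𝒳 → ℝ} (hφ : Continuous φ) (x : 𝒳) :
    Continuous fun t => (entranceDensity Q K B t *ᵥ φ t) x := by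
  have hdensity : Continuous (entranceDensity Q K B) :=
    ((continuous_killedKernel Q K).mul_const Q).mul_const (proj B)
  exact (continuous_apply x).comp (hdensity.matrix_mulVec hφ)

lemma entranceDensity_nonneg (hQ : IsRateMatrix Q) (hBK : B ⊆ K) {t : ℝ} (ht : 0 ≤ t) (x b : 𝒳) :
    0 ≤ entranceDensity Q K B t x b := by
  rw [entranceDensity, proj, mul_diagonal, mul_apply]
  by_cases hb : b ∈ B
  · refine mul_nonneg (Finset.sum_nonneg fun y _ => ?_)
      (Set.indicator_nonneg (fun _ _ => zero_le_one) b)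
    by_cases hy : y ∈ K
    · rw [killedKernel_apply_of_mem_right hy, zero_mul]
    · exact mul_nonneg (killedKernel_nonneg hQ ht x y)
        (hQ.nonneg y b (ne_of_mem_of_not_mem (hBK hb) hy).symm)
  · rw [Set.indicator_of_notMem hb, mul_zero]

lemma entranceDensity_mulVec_le (hQ : IsRateMatrix Q) (hBK : B ⊆ K) {t : ℝ} (ht : 0 ≤ t)
    {φ ψ : 𝒳 → ℝ} (hφψ : ∀ b ∈ B, φ b ≤ ψ b) (x : 𝒳) :
    (entranceDensity Q K B t *ᵥ φ) x ≤ (entranceDensity Q K B t *ᵥ ψ) x := by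
  refine Finset.sum_le_sum fun b _ => ?_
  by_cases hb : b ∈ B
  · exact mul_le_mul_of_nonneg_left (hφψ b hb) (entranceDensity_nonneg hQ hBK ht x b)
  · simp [entranceDensity, proj, hb]

lemma entrance_nonneg (hQ : IsRateMatrix Q) (hBK : B ⊆ K) {R : ℝ} (hR : 0 ≤ R) (x : 𝒳) :
    0 ≤ entrance Q K B R x :=
  add_nonneg (Set.indicator_nonneg (fun _ _ => zero_le_one) x) <|
    intervalIntegral.integral_nonneg hR fun _ ht =>
      dotProduct_nonneg_of_nonneg (entranceDensity_nonneg hQ hBK ht.1 x) fun _ => zero_le_one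

lemma entrance_mono (hQ : IsRateMatrix Q) {C : Set 𝒳} (hBC : B ⊆ C) (hCK : C ⊆ K) {R : ℝ}
    (hR : 0 ≤ R) (x : 𝒳) : entrance Q K B R x ≤ entrance Q K C R x := by
  refine add_le_add (Set.indicator_le_indicator_of_subset hBC (fun _ => zero_le_one) x)
    (intervalIntegral.integral_mono_on hR
      ((continuous_entranceDensity_mulVec continuous_const x).intervalIntegrable 0 R)
      ((continuous_entranceDensity_mulVec continuous_const x).intervalIntegrable 0 R)
      fun t ht => ?_)
  have hrestrict : entranceDensity Q K B t *ᵥ 1 = entranceDensity Q K C t *ᵥ B.indicator 1 := by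
    rw [← proj_mulVec, mulVec_mulVec, entranceDensity, entranceDensity, mul_assoc _ (proj C),
      proj_mul_proj, Set.inter_eq_right.2 hBC]
  rw [hrestrict]
  exact entranceDensity_mulVec_le hQ hCK ht.1
    (fun b _ => Set.indicator_le_self' (fun _ _ => zero_le_one) b) x

lemma killedKernel_mul_killedRates (hGK : G ⊆ K) (t : ℝ) :
    killedKernel Q K t * killedRates Q G = killedKernel Q K t * Q * proj Gᶜ := by
  have hproj : killedKernel Q K t * proj Gᶜ = killedKernel Q K t := by
    rw [← killedKernel_mul_proj, mul_assoc, proj_mul_proj,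
      Set.inter_eq_left.2 (Set.compl_subset_compl.2 hGK)]
  rw [killedRates, ← mul_assoc, ← mul_assoc, hproj]

omit [Fintype 𝒳] in
lemma proj_compl_eq_add (hGK : G ⊆ K) : (proj Gᶜ : Matrix 𝒳 𝒳 ℝ) = proj Kᶜ + proj (K \ G) := by
  have hunion : Gᶜ = Kᶜ ∪ K \ G := by grind
  have hdisj : Disjoint Kᶜ (K \ G) := Set.disjoint_left.2 fun _ hx hx' => hx hx'.1
  rw [hunion, proj, proj, proj, diagonal_add, Set.indicator_union_of_disjoint hdisj]

lemma hasDerivAt_killedKernel_mul_killedKernel (hGK : G ⊆ K) (s t : ℝ) :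
    HasDerivAt (fun t => killedKernel Q K t * killedKernel Q G (s - t))
      (-(entranceDensity Q K (K \ G) t * killedKernel Q G (s - t))) t := by
  have hderiv := (hasDerivAt_killedKernel Q K t).mul
    ((hasDerivAt_killedKernel Q G (s - t)).comp_const_sub s t)
  refine hderiv.congr_deriv ?_
  rw [← killedKernel_mul_killedRates_comm Q G, mul_neg, ← mul_assoc,
    killedKernel_mul_killedRates subset_rfl, killedKernel_mul_killedRates hGK,
    proj_compl_eq_add hGK, entranceDensity]
  noncomm_ring

/- Differentiating the kernel of the chain killed on `K` up to time `t` and on `G` after time `t`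
decomposes the paths according to the point of entrance into `K \ G`. -/
lemma killedKernel_add_mulVec (hGK : G ⊆ K) (s R : ℝ) (φ : 𝒳 → ℝ) (x : 𝒳) :
    (killedKernel Q G (s + R) *ᵥ φ) x =
      (killedKernel Q K R *ᵥ (killedKernel Q G s *ᵥ φ)) x +
        (K \ G).indicator (killedKernel Q G (s + R) *ᵥ φ) x +
        ∫ t in 0..R, (entranceDensity Q K (K \ G) t *ᵥ (killedKernel Q G (s + R - t) *ᵥ φ)) x := by
  have hderiv : ∀ t, HasDerivAt
      (fun t => ((killedKernel Q K t * killedKernel Q G (s + R - t)) *ᵥ φ) x)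
      (-(entranceDensity Q K (K \ G) t *ᵥ (killedKernel Q G (s + R - t) *ᵥ φ)) x) t := fun t => by
    rw [mulVec_mulVec, ← Pi.neg_apply, ← neg_mulVec]
    exact HasDerivAt.fun_sum fun y _ =>
      ((entryLinearMap ℝ ℝ x y).toContinuousLinearMap.hasFDerivAt.comp_hasDerivAt t
        (hasDerivAt_killedKernel_mul_killedKernel hGK (s + R) t)).mul_const (φ y)
  have hcont : Continuous fun t =>
      -(entranceDensity Q K (K \ G) t *ᵥ (killedKernel Q G (s + R - t) *ᵥ φ)) x :=
    (continuous_entranceDensity_mulVec (((continuous_killedKernel Q G).comp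
      (continuous_const.sub continuous_id)).matrix_mulVec continuous_const) x).neg
  have hint := intervalIntegral.integral_eq_sub_of_hasDerivAt (fun t _ => hderiv t)
    (hcont.intervalIntegrable 0 R)
  have hstart : killedKernel Q K 0 * killedKernel Q G (s + R - 0) =
      killedKernel Q G (s + R) - proj (K \ G) * killedKernel Q G (s + R) := by
    rw [killedKernel_zero, sub_zero, eq_sub_iff_add_eq, ← add_mul, ← proj_compl_eq_add hGK,
      proj_mul_killedKernel]
  rw [intervalIntegral.integral_neg, hstart, add_sub_cancel_right, sub_mulVec, ← mulVec_mulVec,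
    ← mulVec_mulVec, proj_mulVec, Pi.sub_apply] at hint
  linarith

lemma entrance_mul_add_le (hQ : IsRateMatrix Q) (hGK : G ⊆ K) (s R : ℝ≥0) {φ : 𝒳 → ℝ} {l : ℝ}
    (hl : ∀ u ∈ Set.Icc s (s + R), ∀ b ∈ K \ G, l ≤ (killedSemigroup Q G u *ᵥ φ) b) (x : 𝒳) :
    entrance Q K (K \ G) R x * l + (killedSemigroup Q K R *ᵥ (killedSemigroup Q G s *ᵥ φ)) x ≤
      (killedSemigroup Q G (s + R) *ᵥ φ) x := by
  have hnow : (K \ G).indicator 1 x * l ≤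
      (K \ G).indicator (killedKernel Q G (s + R) *ᵥ φ) x := by
    by_cases hx : x ∈ K \ G
    · simpa [Set.indicator_of_mem hx, killedSemigroup] using hl (s + R) ⟨le_self_add, le_rfl⟩ x hx
    · simp only [Set.indicator_of_notMem hx, zero_mul, le_refl]
  have hlater : (∫ t in (0 : ℝ)..R, (entranceDensity Q K (K \ G) t *ᵥ 1) x) * l ≤
      ∫ t in (0 : ℝ)..R,
        (entranceDensity Q K (K \ G) t *ᵥ (killedKernel Q G (s + R - t) *ᵥ φ)) x := by
    rw [← intervalIntegral.integral_mul_const]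
    refine intervalIntegral.integral_mono_on R.2
      (((continuous_entranceDensity_mulVec continuous_const x).mul_const l).intervalIntegrable 0 R)
      ((continuous_entranceDensity_mulVec (((continuous_killedKernel Q G).comp
        (continuous_const.sub continuous_id)).matrix_mulVec continuous_const)
          x).intervalIntegrable 0 R) fun t ht => ?_
    rw [mul_comm, ← smul_eq_mul, ← Pi.smul_apply, ← mulVec_smul]
    refine entranceDensity_mulVec_le hQ Set.sdiff_subset ht.1 (fun b hb => ?_) x
    lift t to ℝ≥0 using ht.1
    have htR : t ≤ R := ht.2
    simpa [killedSemigroup, NNReal.coe_sub (htR.trans le_add_self)] using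
      hl (s + R - t) ⟨by rw [add_tsub_assoc_of_le htR]; exact le_self_add, tsub_le_self⟩ b hb
  rw [entrance, add_mul]
  exact (add_le_add_left (add_le_add hnow hlater) _).trans_eq <| by
    simp only [killedSemigroup, NNReal.coe_add]
    rw [killedKernel_add_mulVec hGK]
    ring

lemma le_entrance_mul_add (hQ : IsRateMatrix Q) (hGK : G ⊆ K) (s R : ℝ≥0) {φ : 𝒳 → ℝ} {l : ℝ}
    (hl : ∀ u ∈ Set.Icc s (s + R), ∀ b ∈ K \ G, (killedSemigroup Q G u *ᵥ φ) b ≤ l) (x : 𝒳) :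
    (killedSemigroup Q G (s + R) *ᵥ φ) x ≤
      entrance Q K (K \ G) R x * l +
        (killedSemigroup Q K R *ᵥ (killedSemigroup Q G s *ᵥ φ)) x := by
  have hneg := entrance_mul_add_le hQ hGK s R (φ := -φ) (l := -l) (fun u hu b hb => by
    simpa only [mulVec_neg, Pi.neg_apply, neg_le_neg_iff] using hl u hu b hb) x
  simp only [mulVec_neg, Pi.neg_apply] at hneg
  linarith

lemma entrance_add_mass_le_one (hQ : IsRateMatrix Q) (hBK : B ⊆ K) (R : ℝ≥0) (x : 𝒳) :
    entrance Q K B R x + mass (killedSemigroup Q K) R x ≤ 1 := by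
  have hone : ∀ u : ℝ≥0, killedSemigroup Q ∅ u *ᵥ 1 = 1 := fun u => by
    rw [killedSemigroup_empty, semigroup_mulVec_one hQ]
  have hfull := entrance_mul_add_le hQ (Set.empty_subset K) 0 R (φ := 1) (l := 1)
    (fun u _ b _ => (congrFun (hone u) b).ge) x
  rw [Set.sdiff_empty, hone, hone, mul_one] at hfull
  exact (add_le_add_left (entrance_mono hQ hBK subset_rfl R.2 x) _).trans hfull

end Entrance

section SampledKernel

attribute [local instance] Matrix.linftyOpNormedRing Matrix.linftyOpNormedAlgebra

variable {𝒳 : Type*} [Fintype 𝒳] [DecidableEq 𝒳]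

/-- The kernel of one step of the chain sampled at mesh `h` and killed on `G`. -/
def sampledKernel (Q : Matrix 𝒳 𝒳 ℝ) (G : Set 𝒳) (h : ℝ) : Matrix 𝒳 𝒳 ℝ :=
  NormedSpace.exp (h • Q) * proj Gᶜ

lemma norm_le_one_of_mulVec_one_le {M : Matrix 𝒳 𝒳 ℝ} (hM : ∀ x y, 0 ≤ M x y)
    (hM1 : ∀ x, (M *ᵥ 1) x ≤ 1) : ‖M‖ ≤ 1 := by
  rw [linfty_opNorm_def, NNReal.coe_le_one]
  refine Finset.sup_le fun x _ => ?_
  rw [← NNReal.coe_le_coe, NNReal.coe_sum, NNReal.coe_one]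
  simpa only [coe_nnnorm, Real.norm_of_nonneg (hM x _), mulVec, dotProduct_one] using hM1 x

variable {Q : Matrix 𝒳 𝒳 ℝ} {G : Set 𝒳}

lemma norm_killedKernel_le_one (hQ : IsRateMatrix Q) (G : Set 𝒳) {t : ℝ} (ht : 0 ≤ t) :
    ‖killedKernel Q G t‖ ≤ 1 :=
  norm_le_one_of_mulVec_one_le (killedKernel_nonneg hQ ht)
    ((isSubMarkovSemigroup_killedSemigroup hQ G).mass_le ⟨t, ht⟩)

lemma norm_sampledKernel_le_one (hQ : IsRateMatrix Q) {t : ℝ} (ht : 0 ≤ t) :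
    ‖sampledKernel Q G t‖ ≤ 1 := by
  refine (norm_mul_le _ _).trans (mul_le_one₀ ?_ (norm_nonneg _) ?_)
  · exact killedKernel_empty Q t ▸ norm_killedKernel_le_one hQ ∅ ht
  · exact killedKernel_zero Q G ▸ norm_killedKernel_le_one hQ G le_rfl

lemma hasDerivAt_proj_mul_sampledKernel_sub (Q : Matrix 𝒳 𝒳 ℝ) (G : Set 𝒳) :
    HasDerivAt (fun h => proj Gᶜ * sampledKernel Q G h - killedKernel Q G h) 0 0 := by
  have hexp := ((hasDerivAt_exp_smul_const (𝕂 := ℝ) Q (0 : ℝ)).mul_const (proj Gᶜ)).const_mul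
    (proj Gᶜ)
  refine (hexp.sub (hasDerivAt_killedKernel Q G 0)).congr_deriv ?_
  rw [killedKernel_zero, proj_mul_killedRates, zero_smul, NormedSpace.exp_zero, one_mul,
    killedRates, mul_assoc, sub_self]

lemma norm_proj_mul_sampledKernel_pow_sub_le (hQ : IsRateMatrix Q) {h : ℝ} (hh : 0 ≤ h) (N : ℕ) :
    ‖proj Gᶜ * sampledKernel Q G h ^ N - killedKernel Q G (N * h)‖ ≤
      N * ‖proj Gᶜ * sampledKernel Q G h - killedKernel Q G h‖ := by
  induction N with
  | zero => simp [killedKernel_zero]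
  | succ N ih =>
    have hsplit : proj Gᶜ * sampledKernel Q G h ^ (N + 1) - killedKernel Q G ((N + 1 : ℕ) * h) =
        (proj Gᶜ * sampledKernel Q G h ^ N - killedKernel Q G (N * h)) * sampledKernel Q G h +
          killedKernel Q G (N * h) * (proj Gᶜ * sampledKernel Q G h - killedKernel Q G h) := by
      rw [Nat.cast_succ, add_one_mul, killedKernel_add, sub_mul, mul_sub, ← mul_assoc _ (proj Gᶜ),
        killedKernel_mul_proj, pow_succ, ← mul_assoc]
      abel
    rw [hsplit, Nat.cast_succ, add_one_mul]
    refine (norm_add_le _ _).trans (add_le_add ?_ ?_)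
    · exact (norm_mul_le_of_le ih (norm_sampledKernel_le_one hQ hh)).trans_eq (mul_one _)
    · exact (norm_mul_le_of_le (norm_killedKernel_le_one hQ G (by positivity)) le_rfl).trans_eq
        (one_mul _)

/- Both kernels are contractions with the same derivative at `0`, so replacing one by the other at
each of the `2 ^ n` steps costs `2 ^ n * o(2 ^ -n)`. -/
lemma tendsto_proj_mul_sampledKernel_pow (hQ : IsRateMatrix Q) (G : Set 𝒳) (t : ℝ≥0) :
    Tendsto (fun n : ℕ => proj Gᶜ * sampledKernel Q G (t / 2 ^ n) ^ 2 ^ n) atTop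
      (𝓝 (killedSemigroup Q G t)) := by
  have hstep : Tendsto (fun n : ℕ => (t : ℝ) / 2 ^ n) atTop (𝓝 0) :=
    tendsto_const_nhds.div_atTop (tendsto_pow_atTop_atTop_of_one_lt one_lt_two)
  have hφ := (hasDerivAt_proj_mul_sampledKernel_sub Q G).isLittleO
  simp only [sampledKernel, killedKernel_zero, zero_smul, NormedSpace.exp_zero, one_mul,
    proj_mul_proj, Set.inter_self, sub_self, smul_zero, sub_zero] at hφ
  have hbig : (fun n : ℕ => (t : ℝ) / 2 ^ n) =O[atTop] fun n => (1 / 2 ^ n : ℝ) :=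
    Asymptotics.isBigO_of_le' (c := t) _ fun n => by simp [div_eq_mul_inv]
  have hsmall := ((hφ.comp_tendsto hstep).trans_isBigO hbig).norm_left.tendsto_div_nhds_zero
  refine tendsto_iff_norm_sub_tendsto_zero.2 <|
    squeeze_zero (fun _ => norm_nonneg _) (fun n => ?_) hsmall
  have hN : ((2 ^ n : ℕ) : ℝ) * (t / 2 ^ n) = t := by
    push_cast
    field_simp
  have hle := norm_proj_mul_sampledKernel_pow_sub_le (G := G) hQ (h := t / 2 ^ n) (by positivity)
    (2 ^ n)
  rw [hN] at hle
  refine hle.trans_eq ?_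
  rw [div_div_eq_mul_div, div_one, mul_comm]
  push_cast
  rfl

end SampledKernel

section Paths

/-- The points of the dyadic grid of mesh `T / 2 ^ n`. -/
def gridPt (T : ℝ≥0) (n k : ℕ) : ℝ≥0 := k * (T / 2 ^ n)

lemma gridPt_succ (T : ℝ≥0) (n k : ℕ) : gridPt T (n + 1) (2 * k) = gridPt T n k := by
  simp only [gridPt, pow_succ]
  push_cast
  field_simp

lemma gridPt_pow (T : ℝ≥0) (n : ℕ) : gridPt T n (2 ^ n) = T := by
  simp only [gridPt]
  push_cast
  field_simp

lemma gridPt_mono (T : ℝ≥0) (n : ℕ) : Monotone (gridPt T n) := fun i j hij => by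
  unfold gridPt
  gcongr

lemma gridPt_le {T : ℝ≥0} {n k : ℕ} (hk : k ≤ 2 ^ n) : gridPt T n k ≤ T :=
  (gridPt_mono T n hk).trans_eq (gridPt_pow T n)

lemma exists_gridPt_mem_Ico {T u v : ℝ≥0} (huT : u < T) (huv : u < v) :
    ∃ n k, k ≤ 2 ^ n ∧ gridPt T n k ∈ Set.Ico u v := by
  have hT : 0 < T := lt_of_le_of_lt zero_le huT
  have hlim : Tendsto (fun n : ℕ => T * (1 / 2 : ℝ≥0) ^ n) atTop (𝓝 (T * 0)) := by
    refine tendsto_const_nhds.mul ?_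
    rw [← NNReal.tendsto_coe]
    push_cast
    exact tendsto_pow_atTop_nhds_zero_of_lt_one (by norm_num) (by norm_num)
  rw [mul_zero] at hlim
  obtain ⟨n, hn⟩ := (hlim.eventually (gt_mem_nhds (tsub_pos_of_lt huv))).exists
  have hn' : T / 2 ^ n < v - u := by
    rwa [one_div, inv_pow, ← div_eq_mul_inv] at hn
  have hmesh : 0 < T / 2 ^ n := by positivity
  refine ⟨n, ⌈u / (T / 2 ^ n)⌉₊, ?_, ?_, ?_⟩
  · refine Nat.ceil_le.mpr ?_
    rw [div_le_iff₀ hmesh]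
    push_cast
    rw [mul_div_cancel₀ _ (by positivity)]
    exact huT.le
  · unfold gridPt
    rw [← div_le_iff₀ hmesh]
    exact Nat.le_ceil _
  · unfold gridPt
    have hceil : (⌈u / (T / 2 ^ n)⌉₊ : ℝ≥0) < u / (T / 2 ^ n) + 1 := Nat.ceil_lt_add_one zero_le
    calc (⌈u / (T / 2 ^ n)⌉₊ : ℝ≥0) * (T / 2 ^ n) < (u / (T / 2 ^ n) + 1) * (T / 2 ^ n) := by
          gcongr
      _ = u + T / 2 ^ n := by rw [add_mul, one_mul, div_mul_cancel₀ _ hmesh.ne']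
      _ < u + (v - u) := by gcongr
      _ = v := add_tsub_cancel_of_le huv.le

lemma exists_gridPt_of_exists {T : ℝ≥0} {p : ℝ≥0 → Prop}
    (hp : ∀ u, p u → ∀ᶠ s in 𝓝[≥] u, p s) {u : ℝ≥0} (hu : u ≤ T) (hpu : p u) :
    ∃ n k, k ≤ 2 ^ n ∧ p (gridPt T n k) := by
  rcases hu.lt_or_eq with hlt | rfl
  · obtain ⟨v, hv, hsub⟩ := mem_nhdsGE_iff_exists_Ico_subset' hlt |>.mp (hp u hpu)
    obtain ⟨n, k, hk, hmem⟩ := exists_gridPt_mem_Ico hlt hv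
    exact ⟨n, k, hk, hsub hmem⟩
  · exact ⟨0, 1, by simp, by simpa [gridPt] using hpu⟩

variable {𝒳 Ω : Type*}

lemma coe_lt_hit_iff {X : ℝ≥0 → Ω → 𝒳} {ω : Ω}
    (hrc : ∀ t, ∀ᶠ s in 𝓝[≥] t, X s ω = X t ω) (K : Set 𝒳) (t : ℝ≥0) :
    (t : ℝ≥0∞) < hit X K ω ↔ ∀ s ≤ t, X s ω ∉ K := by
  constructor
  · intro h s hs hmem
    have hle : hit X K ω ≤ s := iInf₂_le s hmem
    exact (h.trans_le hle).not_ge (ENNReal.coe_le_coe.2 hs)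
  · intro h
    obtain ⟨v, hv, hsub⟩ := (mem_nhdsGE_iff_exists_Ico_subset' (lt_add_one t)).mp (hrc t)
    refine (ENNReal.coe_lt_coe.2 hv).trans_le (le_iInf₂ fun s hs => ?_)
    by_contra! hlt
    have hsv : s < v := ENNReal.coe_lt_coe.1 hlt
    rcases le_total s t with hst | hst
    · exact h s hst hs
    · have hconst : X s ω = X t ω := hsub ⟨hst, hsv⟩
      exact h t le_rfl (hconst ▸ hs)

lemma measurableSet_past {X : ℝ≥0 → Ω → 𝒳} {u s : ℝ≥0} (hu : u ≤ s) (F : Set 𝒳) :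
    MeasurableSet[past X s] {ω | X u ω ∈ F} := by
  have hle : MeasurableSpace.comap (X u) ⊤ ≤ past X s :=
    le_iSup (fun u : Set.Iic s => MeasurableSpace.comap (X u) ⊤) ⟨u, hu⟩
  exact hle _ ⟨F, trivial, rfl⟩

lemma past_mono {X : ℝ≥0 → Ω → 𝒳} {s t : ℝ≥0} (hst : s ≤ t) : past X s ≤ past X t :=
  iSup_le fun u => le_iSup (fun u : Set.Iic t => MeasurableSpace.comap (X u) ⊤)
    ⟨u, Set.mem_Iic.mpr (le_trans (Set.mem_Iic.mp u.2) hst)⟩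

lemma measurableSet_grid_past (X : ℝ≥0 → Ω → 𝒳) (G : Set 𝒳) (s t : ℝ≥0) (n : ℕ) :
    MeasurableSet[past X (s + t)] {ω | ∀ k ≤ 2 ^ n, X (s + gridPt t n k) ω ∉ G} := by
  simp only [Set.ofPred_forall]
  refine MeasurableSet.iInter fun k => MeasurableSet.iInter fun hk => ?_
  exact measurableSet_past (by gcongr; exact gridPt_le hk) Gᶜ

lemma noHit_add_iff (X : ℝ≥0 → Ω → 𝒳) (G : Set 𝒳) (s t : ℝ≥0) (ω : Ω) :
    (∀ u ≤ s + t, X u ω ∉ G) ↔ (∀ u ≤ s, X u ω ∉ G) ∧ ∀ u ≤ t, X (s + u) ω ∉ G := by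
  constructor
  · exact fun h => ⟨fun u hu => h u (hu.trans le_self_add), fun u hu => h _ (by gcongr)⟩
  · rintro ⟨hbefore, hafter⟩ u hu
    rcases le_total u s with hus | hus
    · exact hbefore u hus
    · obtain ⟨v, rfl⟩ := exists_add_of_le hus
      exact hafter v (by simpa using hu)

variable [MeasurableSpace Ω]

lemma real_inter_notMem_inter_eq [DecidableEq 𝒳] (m : Measure Ω) (X : Ω → 𝒳) (G : Set 𝒳) (y z : 𝒳)
    (E : Set Ω) :
    m.real (E ∩ {ω | X ω = y} ∩ {ω | X ω ∉ G} ∩ {ω | X ω = z}) =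
      m.real (E ∩ {ω | X ω = y}) * proj Gᶜ y z := by
  by_cases hyz : y = z ∧ y ∉ G
  · obtain ⟨rfl, hy⟩ := hyz
    have hset : E ∩ {ω | X ω = y} ∩ {ω | X ω ∉ G} ∩ {ω | X ω = y} =
        E ∩ {ω | X ω = y} := by
      ext ω
      simp only [Set.mem_inter_iff, Set.mem_ofPred_eq]
      grind
    rw [hset]
    simp [proj, hy]
  · have hset : E ∩ {ω | X ω = y} ∩ {ω | X ω ∉ G} ∩ {ω | X ω = z} = ∅ := by
      ext ω
      simp only [Set.mem_inter_iff, Set.mem_ofPred_eq, Set.mem_empty_iff_false]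
      grind
    have hzero : (proj Gᶜ : Matrix 𝒳 𝒳 ℝ) y z = 0 := by
      rcases eq_or_ne y z with rfl | hne
      · simpa [proj] using hyz
      · exact diagonal_apply_ne _ hne
    rw [hset, measureReal_empty, hzero, mul_zero]

variable [Fintype 𝒳] [DecidableEq 𝒳]

namespace IsMarkovChain

variable {Q : Matrix 𝒳 𝒳 ℝ} {P : 𝒳 → Measure Ω} {X : ℝ≥0 → Ω → 𝒳}
  (hX : IsMarkovChain Q P X)
include hX

lemma measurableSet_mem (t : ℝ≥0) (F : Set 𝒳) : MeasurableSet {ω | X t ω ∈ F} := by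
  have hunion : {ω | X t ω ∈ F} = ⋃ y ∈ F, {ω | X t ω = y} := by ext; simp
  rw [hunion]
  exact MeasurableSet.biUnion (Set.to_countable F) fun y _ => hX.meas t y

lemma past_le (s : ℝ≥0) : past X s ≤ ‹MeasurableSpace Ω› := by
  refine iSup_le fun u => ?_
  rintro _ ⟨F, -, rfl⟩
  exact hX.measurableSet_mem u F

lemma real_eq_sum (x : 𝒳) (t : ℝ≥0) (E : Set Ω) :
    (P x).real E = ∑ w, (P x).real (E ∩ {ω | X t ω = w}) := by
  have := hX.prob x
  have hsum := sum_measureReal_preimage_singleton (μ := (P x).restrict E) (f := X t) Finset.univ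
    (fun y _ => hX.meas t y)
  simp only [Finset.coe_univ, Set.preimage_univ, measureReal_restrict_apply_univ] at hsum
  rw [← hsum]
  refine Finset.sum_congr rfl fun w _ => ?_
  rw [measureReal_restrict_apply (show MeasurableSet (X t ⁻¹' {w}) from hX.meas t w),
    Set.inter_comm]
  rfl

lemma noHit_eq_iInter_grid (G : Set 𝒳) (s t : ℝ≥0) :
    {ω | ∀ u ≤ t, X (s + u) ω ∉ G} =
      ⋂ n, {ω | ∀ k ≤ 2 ^ n, X (s + gridPt t n k) ω ∉ G} := by
  ext ω
  simp only [Set.mem_ofPred_eq, Set.mem_iInter]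
  constructor
  · exact fun h n k hk => h _ (gridPt_le hk)
  · intro h u hu hmem
    obtain ⟨n, k, hk, hmem'⟩ := exists_gridPt_of_exists (p := fun u => X (s + u) ω ∈ G)
      (fun u hpu => by
        have hshift : Tendsto (fun v => s + v) (𝓝[≥] u) (𝓝[≥] (s + u)) := by
          refine tendsto_nhdsWithin_iff.mpr ⟨?_, ?_⟩
          · exact (continuous_const.add continuous_id).continuousAt.mono_left nhdsWithin_le_nhds
          · filter_upwards [self_mem_nhdsWithin] with v hv
            exact add_le_add_right hv s
        filter_upwards [hshift.eventually (hX.rightCont ω (s + u))] with v hv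
        rwa [hv]) hu hmem
    exact h n k hk hmem'

lemma measurableSet_noHit_past (G : Set 𝒳) (t : ℝ≥0) :
    MeasurableSet[past X t] {ω | ∀ u ≤ t, X u ω ∉ G} := by
  have hgrid := hX.noHit_eq_iInter_grid G 0 t
  simp only [zero_add] at hgrid
  rw [hgrid]
  refine MeasurableSet.iInter fun n => ?_
  have hmeas := measurableSet_grid_past X G 0 t n
  rw [zero_add] at hmeas
  simpa only [zero_add] using hmeas

lemma real_step_eq (x : 𝒳) (G : Set 𝒳) {s : ℝ≥0} {E : Set Ω} (hE : MeasurableSet[past X s] E)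
    (h : ℝ≥0) (z : 𝒳) :
    (P x).real (E ∩ {ω | X (s + h) ω = z ∧ z ∉ G}) =
      ∑ w, (P x).real (E ∩ {ω | X s ω = w}) * sampledKernel Q G h w z := by
  by_cases hz : z ∈ G
  · simp [sampledKernel, proj, hz]
  · have hkernel : ∀ w, sampledKernel Q G h w z = semigroup Q h w z := fun w => by
      simp [sampledKernel, proj, hz, semigroup]
    simp only [hz, not_false_eq_true, and_true, hkernel]
    rw [hX.real_eq_sum x s]
    refine Finset.sum_congr rfl fun w _ => ?_
    rw [← hX.markov x s h w z E hE, Set.inter_assoc]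
    congr 2
    exact Set.inter_comm _ _

lemma real_grid_eq (x : 𝒳) (G : Set 𝒳) {s : ℝ≥0} {E : Set Ω} (hE : MeasurableSet[past X s] E)
    (h : ℝ≥0) (N : ℕ) (y z : 𝒳) :
    (P x).real (E ∩ {ω | X s ω = y} ∩ {ω | ∀ k ≤ N, X (s + k * h) ω ∉ G} ∩
      {ω | X (s + N * h) ω = z}) =
    (P x).real (E ∩ {ω | X s ω = y}) * (proj Gᶜ * sampledKernel Q G h ^ N) y z := by
  induction N generalizing z with
  | zero => simpa using real_inter_notMem_inter_eq (P x) (X s) G y z E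
  | succ N ih =>
    set F : Set Ω := E ∩ {ω | X s ω = y} ∩ {ω | ∀ k ≤ N, X (s + k * h) ω ∉ G}
    have hF : MeasurableSet[past X (s + N * h)] F := by
      refine ((past_mono le_self_add _ hE).inter (measurableSet_past le_self_add {y})).inter ?_
      simp only [Set.ofPred_forall]
      exact MeasurableSet.iInter fun k => MeasurableSet.iInter fun hk =>
        measurableSet_past (by gcongr) Gᶜ
    have hset : E ∩ {ω | X s ω = y} ∩ {ω | ∀ k ≤ N + 1, X (s + k * h) ω ∉ G} ∩
        {ω | X (s + (N + 1 : ℕ) * h) ω = z} = F ∩ {ω | X (s + N * h + h) ω = z ∧ z ∉ G} := by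
      ext ω
      simp only [F, Set.mem_inter_iff, Set.mem_ofPred_eq, Nat.le_succ_iff, or_imp, forall_and,
        forall_eq, Nat.cast_succ, add_one_mul, ← add_assoc]
      grind
    rw [hset, hX.real_step_eq x G hF, pow_succ, ← mul_assoc, mul_apply, Finset.mul_sum]
    exact Finset.sum_congr rfl fun w _ => by rw [ih, mul_assoc]

lemma tendsto_real_grid (x : 𝒳) (G : Set 𝒳) (s t : ℝ≥0) {C : Set Ω} (hC : MeasurableSet C) :
    Tendsto (fun n => (P x).real (C ∩ {ω | ∀ k ≤ 2 ^ n, X (s + gridPt t n k) ω ∉ G})) atTop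
      (𝓝 ((P x).real (C ∩ {ω | ∀ u ≤ t, X (s + u) ω ∉ G}))) := by
  have := hX.prob x
  rw [hX.noHit_eq_iInter_grid, Set.inter_iInter]
  refine (ENNReal.tendsto_toReal (measure_ne_top _ _)).comp
    (tendsto_measure_iInter_atTop (fun n => ?_) ?_ ⟨0, measure_ne_top _ _⟩)
  · exact (hC.inter (hX.past_le _ _ (measurableSet_grid_past X G s t n))).nullMeasurableSet
  · refine antitone_nat_of_succ_le fun n => Set.inter_subset_inter_right C ?_
    intro ω hω k hk
    rw [← gridPt_succ]
    exact hω (2 * k) (by rw [pow_succ]; omega)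

lemma real_inter_start (x : 𝒳) (E : Set Ω) : (P x).real (E ∩ {ω | X 0 ω = x}) = (P x).real E := by
  have := hX.prob x
  refine le_antisymm (measureReal_mono Set.inter_subset_left) ?_
  have hnull : (P x).real {ω | X 0 ω = x}ᶜ = 0 := by
    rw [probReal_compl_eq_one_sub (hX.meas 0 x), hX.start x, sub_self]
  have hcover : E ⊆ (E ∩ {ω | X 0 ω = x}) ∪ {ω | X 0 ω = x}ᶜ := fun ω hω =>
    (em (X 0 ω = x)).imp (And.intro hω) id
  refine (measureReal_mono hcover).trans ((measureReal_union_le _ _).trans ?_)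
  rw [hnull, add_zero]

lemma markov_killed (hQ : IsRateMatrix Q) (x : 𝒳) (G : Set 𝒳) {s : ℝ≥0} {E : Set Ω}
    (hE : MeasurableSet[past X s] E) (t : ℝ≥0) (y z : 𝒳) :
    (P x).real (E ∩ {ω | X s ω = y} ∩ {ω | X (s + t) ω = z ∧ ∀ u ≤ t, X (s + u) ω ∉ G}) =
      (P x).real (E ∩ {ω | X s ω = y}) * killedSemigroup Q G t y z := by
  have hgrid := hX.tendsto_real_grid x G s t (C := E ∩ {ω | X s ω = y} ∩ {ω | X (s + t) ω = z})
    (((hX.past_le _ _ hE).inter (hX.meas _ _)).inter (hX.meas _ _))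
  rw [Set.inter_assoc _ _ {ω | ∀ u ≤ t, X (s + u) ω ∉ G}] at hgrid
  have hkernel := tendsto_pi_nhds.1
    (tendsto_pi_nhds.1 (tendsto_proj_mul_sampledKernel_pow hQ G t) y) z
  refine tendsto_nhds_unique (hgrid.congr fun n => ?_) (hkernel.const_mul _)
  have hmesh : ((2 ^ n : ℕ) : ℝ≥0) * (t / 2 ^ n) = t := gridPt_pow t n
  have heq := hX.real_grid_eq x G hE (t / 2 ^ n) (2 ^ n) y z
  rw [hmesh] at heq
  rw [Set.inter_right_comm]
  simpa [gridPt] using heq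

lemma real_killed_eq (hQ : IsRateMatrix Q) (x : 𝒳) (G : Set 𝒳) (t : ℝ≥0) (y : 𝒳) :
    (P x).real {ω | X t ω = y ∧ (t : ℝ≥0∞) < hit X G ω} = killedSemigroup Q G t x y := by
  have hmarkov := hX.markov_killed hQ x G (s := 0) MeasurableSet.univ t x y
  simp only [Set.univ_inter, zero_add, hX.start x, one_mul] at hmarkov
  rw [Set.inter_comm, hX.real_inter_start] at hmarkov
  simpa only [coe_lt_hit_iff (hX.rightCont _)] using hmarkov

lemma real_lt_hit_eq (hQ : IsRateMatrix Q) (x : 𝒳) (G : Set 𝒳) (t : ℝ≥0) :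
    (P x).real {ω | (t : ℝ≥0∞) < hit X G ω} = mass (killedSemigroup Q G) t x := by
  rw [hX.real_eq_sum x t, ← sum_eq_mass]
  refine Finset.sum_congr rfl fun y _ => ?_
  rw [← hX.real_killed_eq hQ, Set.inter_comm]
  rfl

lemma evol_eq_semigroup (hQ : IsRateMatrix Q) (x : 𝒳) (t : ℝ≥0) :
    evol P X x t = semigroup Q t x := by
  ext y
  rw [evol, ← killedSemigroup_empty, ← hX.real_killed_eq hQ]
  simp [hit]

lemma mass_add_semigroup_le_one (hQ : IsRateMatrix Q) {G : Set 𝒳} {g : 𝒳} (hg : g ∈ G) (t : ℝ≥0)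
    (x : 𝒳) : mass (killedSemigroup Q G) t x + semigroup Q t x g ≤ 1 := by
  have := hX.prob x
  rw [← hX.real_lt_hit_eq hQ, ← hX.evol_eq_semigroup hQ, evol,
    ← measureReal_union _ (hX.meas t g)]
  · exact measureReal_le_one
  · refine Set.disjoint_left.2 fun ω hω hg' => ?_
    exact (coe_lt_hit_iff (hX.rightCont ω) G t).1 hω t le_rfl (hg' ▸ hg)

lemma real_lt_hit_and_lt_hit_eq (hQ : IsRateMatrix Q) {G K : Set 𝒳} (hGK : G ⊆ K) (s t : ℝ≥0)
    (x : 𝒳) :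
    (P x).real {ω | ((s + t : ℝ≥0) : ℝ≥0∞) < hit X G ω ∧ (s : ℝ≥0∞) < hit X K ω} =
      (killedSemigroup Q K s *ᵥ mass (killedSemigroup Q G) t) x := by
  have hset : {ω | ((s + t : ℝ≥0) : ℝ≥0∞) < hit X G ω ∧ (s : ℝ≥0∞) < hit X K ω} =
      {ω | ∀ u ≤ s, X u ω ∉ K} ∩ {ω | ∀ u ≤ t, X (s + u) ω ∉ G} := by
    ext ω
    simp only [Set.mem_inter_iff, Set.mem_ofPred_eq, coe_lt_hit_iff (hX.rightCont ω),
      noHit_add_iff]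
    exact ⟨fun h => ⟨h.2, h.1.2⟩, fun h => ⟨⟨fun u hu hG => h.1 u hu (hGK hG), h.2⟩, h.1⟩⟩
  rw [hset, hX.real_eq_sum x s, mulVec, dotProduct]
  refine Finset.sum_congr rfl fun y _ => ?_
  have hy : (P x).real ({ω | ∀ u ≤ s, X u ω ∉ K} ∩ {ω | X s ω = y}) =
      killedSemigroup Q K s x y := by
    rw [← hX.real_killed_eq hQ, Set.inter_comm]
    simp only [coe_lt_hit_iff (hX.rightCont _)]
    rfl
  rw [hX.real_eq_sum x (s + t), ← sum_eq_mass, ← hy, Finset.mul_sum]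
  refine Finset.sum_congr rfl fun z _ => ?_
  rw [← hX.markov_killed hQ x G (hX.measurableSet_noHit_past K s), Set.inter_right_comm _ _
    {ω | X s ω = y}, Set.inter_assoc, Set.inter_comm {ω | ∀ u ≤ t, X (s + u) ω ∉ G}]
  rfl

lemma measurableSet_lt_hit (G : Set 𝒳) (t : ℝ≥0) : MeasurableSet {ω | (t : ℝ≥0∞) < hit X G ω} := by
  simp only [coe_lt_hit_iff (hX.rightCont _)]
  exact hX.past_le t _ (hX.measurableSet_noHit_past G t)

lemma real_lt_hit_and_hit_le_eq (hQ : IsRateMatrix Q) {G K : Set 𝒳} (hGK : G ⊆ K) (s t : ℝ≥0)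
    (x : 𝒳) :
    (P x).real {ω | ((s + t : ℝ≥0) : ℝ≥0∞) < hit X G ω ∧ hit X K ω ≤ s} =
      mass (killedSemigroup Q G) (s + t) x -
        (killedSemigroup Q K s *ᵥ mass (killedSemigroup Q G) t) x := by
  have := hX.prob x
  rw [← hX.real_lt_hit_and_lt_hit_eq hQ hGK, ← hX.real_lt_hit_eq hQ, eq_sub_iff_add_eq',
    ← measureReal_inter_add_sdiff (s := {ω | ((s + t : ℝ≥0) : ℝ≥0∞) < hit X G ω})
      (hX.measurableSet_lt_hit K s)]
  congr 2
  ext ω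
  simp only [Set.mem_sdiff, Set.mem_ofPred_eq, not_lt]

end IsMarkovChain

end Paths

section RestrictedLaw

variable {𝒳 : Type*} [Fintype 𝒳]

lemma real_fromLaw {Ω : Type*} [MeasurableSpace Ω] {P : 𝒳 → Measure Ω} [∀ x, IsFiniteMeasure (P x)]
    {ν : 𝒳 → ℝ} (hν : 0 ≤ ν) (E : Set Ω) :
    (fromLaw P ν).real E = ν ⬝ᵥ fun x => (P x).real E := by
  rw [fromLaw, Measure.real, Measure.finsetSum_apply, ENNReal.toReal_sum, dotProduct]
  · refine Finset.sum_congr rfl fun x _ => ?_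
    rw [Measure.smul_apply, smul_eq_mul, ENNReal.toReal_mul, ENNReal.toReal_ofReal (hν x),
      Measure.real]
  · exact fun x _ => (ENNReal.mul_lt_top ENNReal.ofReal_lt_top (measure_lt_top _ _)).ne

lemma restricted_dotProduct (π : 𝒳 → ℝ) (A : Set 𝒳) (φ : 𝒳 → ℝ) :
    restricted π A ⬝ᵥ φ = (π ⬝ᵥ A.indicator φ) / ∑ z, A.indicator π z := by
  rw [dotProduct, dotProduct, Finset.sum_div]
  refine Finset.sum_congr rfl fun x _ => ?_
  by_cases hx : x ∈ A
  · rw [restricted, Set.indicator_of_mem hx, Set.indicator_of_mem hx]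
    ring
  · rw [restricted, Set.indicator_of_notMem hx, Set.indicator_of_notMem hx, zero_div, zero_mul,
      mul_zero, zero_div]

variable {π : 𝒳 → ℝ} {A : Set 𝒳} (hpos : ∀ x, 0 < π x)
include hpos

lemma sum_indicator_pos (hA : A.Nonempty) : 0 < ∑ z, A.indicator π z := by
  obtain ⟨a, ha⟩ := hA
  refine Finset.sum_pos' (fun z _ => Set.indicator_nonneg (fun _ _ => (hpos _).le) z)
    ⟨a, Finset.mem_univ a, ?_⟩
  rw [Set.indicator_of_mem ha]
  exact hpos a

lemma restricted_nonneg : 0 ≤ restricted π A := fun x =>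
  div_nonneg (Set.indicator_nonneg (fun _ _ => (hpos _).le) x) <|
    Finset.sum_nonneg fun z _ => Set.indicator_nonneg (fun _ _ => (hpos _).le) z

lemma sum_restricted (hA : A.Nonempty) : ∑ x, restricted π A x = 1 := by
  simp only [restricted]
  rw [← Finset.sum_div, div_self (sum_indicator_pos hpos hA).ne']

variable [DecidableEq 𝒳] {Q : Matrix 𝒳 𝒳 ℝ} {G : Set 𝒳}

lemma restricted_dotProduct_mass_reversedRates (t : ℝ≥0) :
    restricted π Gᶜ ⬝ᵥ mass (killedSemigroup (reversedRates Q π) G) t =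
      restricted π Gᶜ ⬝ᵥ mass (killedSemigroup Q G) t := by
  have hind : ∀ Q' : Matrix 𝒳 𝒳 ℝ,
      Gᶜ.indicator (mass (killedSemigroup Q' G) t) = mass (killedSemigroup Q' G) t := fun Q' =>
    Set.indicator_eq_self.2 fun x hx hxG => hx (mass_killedSemigroup_of_mem hxG t)
  rw [restricted_dotProduct, restricted_dotProduct, hind, hind]
  congr 1
  simp only [dotProduct, ← sum_eq_mass, Finset.mul_sum, killedSemigroup_reversedRates hpos]
  exact Finset.sum_comm

lemma restricted_dotProduct_semigroup_le (hQ : IsRateMatrix Q) (hπ : IsInvariant Q π) {φ : 𝒳 → ℝ}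
    (hφ : 0 ≤ φ) (t : ℝ≥0) :
    restricted π A ⬝ᵥ (semigroup Q t *ᵥ A.indicator φ) ≤ restricted π A ⬝ᵥ φ := by
  have hind : 0 ≤ A.indicator φ := Set.indicator_nonneg fun x _ => hφ x
  have hsemi : 0 ≤ semigroup Q t *ᵥ A.indicator φ := fun x =>
    dotProduct_nonneg_of_nonneg (exp_smul_nonneg hQ.nonneg t.2 x) hind
  rw [restricted_dotProduct, restricted_dotProduct]
  refine div_le_div_of_nonneg_right ?_
    (Finset.sum_nonneg fun z _ => Set.indicator_nonneg (fun _ _ => (hpos _).le) z)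
  calc π ⬝ᵥ A.indicator (semigroup Q t *ᵥ A.indicator φ)
      ≤ π ⬝ᵥ (semigroup Q t *ᵥ A.indicator φ) := dotProduct_le_dotProduct_of_nonneg_left
        (Set.indicator_le_self' fun x _ => hsemi x) fun x => (hpos x).le
    _ = π ⬝ᵥ A.indicator φ := by rw [dotProduct_mulVec, vecMul_semigroup hQ hπ hpos]

end RestrictedLaw

section Return

variable {𝒳 : Type*} [Fintype 𝒳] [DecidableEq 𝒳] {Q : Matrix 𝒳 𝒳 ℝ} {G B K : Set 𝒳}
  (hQ : IsRateMatrix Q)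
include hQ

lemma entrance_le_one (hBK : B ⊆ K) (R : ℝ≥0) (x : 𝒳) : entrance Q K B R x ≤ 1 := by
  linarith [entrance_add_mass_le_one hQ hBK R x,
    (isSubMarkovSemigroup_killedSemigroup hQ K).mass_nonneg R x]

variable (hBG : Disjoint B G)
include hBG

lemma entrance_mul_le_mass_sub (s R : ℝ≥0) {l : ℝ}
    (hl : ∀ b ∈ B, l ≤ mass (killedSemigroup Q G) (s + R) b) (x : 𝒳) :
    entrance Q (G ∪ B) B R x * l ≤ mass (killedSemigroup Q G) (s + R) x -
      (killedSemigroup Q (G ∪ B) R *ᵥ mass (killedSemigroup Q G) s) x := by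
  have hle := entrance_mul_add_le hQ (K := G ∪ B) Set.subset_union_left s R (φ := 1) (l := l)
  rw [Set.union_sdiff_cancel_left hBG.symm.le_bot] at hle
  exact le_sub_iff_add_le.2 (hle (fun u hu b hb => (hl b hb).trans
    ((isSubMarkovSemigroup_killedSemigroup hQ G).mass_anti hu.2 b)) x)

lemma entrance_mul_le_mass (s R : ℝ≥0) {l : ℝ}
    (hl : ∀ b ∈ B, l ≤ mass (killedSemigroup Q G) (s + R) b) (x : 𝒳) :
    entrance Q (G ∪ B) B R x * l ≤ mass (killedSemigroup Q G) (s + R) x :=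
  (entrance_mul_le_mass_sub hQ hBG s R hl x).trans <| sub_le_self _ <|
    dotProduct_nonneg_of_nonneg ((isSubMarkovSemigroup_killedSemigroup hQ (G ∪ B)).nonneg R x)
      ((isSubMarkovSemigroup_killedSemigroup hQ G).mass_nonneg s)

lemma killedSemigroup_mulVec_le (s R : ℝ≥0) {φ : 𝒳 → ℝ} {H l : ℝ}
    (hH : ∀ y, |(killedSemigroup Q G s *ᵥ φ) y| ≤ H)
    (hl : ∀ u ∈ Set.Icc s (s + R), ∀ b ∈ B, (killedSemigroup Q G u *ᵥ φ) b ≤ l) (x : 𝒳) :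
    (killedSemigroup Q G (s + R) *ᵥ φ) x ≤
      H * mass (killedSemigroup Q (G ∪ B)) R x + entrance Q (G ∪ B) B R x * l := by
  have hle := le_entrance_mul_add hQ (K := G ∪ B) Set.subset_union_left s R (φ := φ) (l := l)
  rw [Set.union_sdiff_cancel_left hBG.symm.le_bot] at hle
  have habs := (isSubMarkovSemigroup_killedSemigroup hQ (G ∪ B)).abs_mulVec_le R hH x
  linarith [hle hl x, (le_abs_self _).trans habs]

lemma mass_sub_le_entrance (s R : ℝ≥0) (x : 𝒳) :
    mass (killedSemigroup Q G) (s + R) x -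
      (killedSemigroup Q (G ∪ B) R *ᵥ mass (killedSemigroup Q G) s) x ≤
        entrance Q (G ∪ B) B R x := by
  have hle := le_entrance_mul_add hQ (K := G ∪ B) Set.subset_union_left s R (φ := 1) (l := 1)
    (fun u _ b _ => (isSubMarkovSemigroup_killedSemigroup hQ G).mass_le u b) x
  rw [Set.union_sdiff_cancel_left hBG.symm.le_bot, mul_one] at hle
  exact sub_le_iff_le_add.2 hle

end Return

section Basin

lemma cBar_nonneg {α f r : ℝ} (hc : 0 ≤ r + 2 * f ^ α) : 0 ≤ cBar α f r := by
  rw [cBar, sub_nonneg, Real.sqrt_le_iff]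
  constructor
  · norm_num
  · linarith

lemma le_eps2 {α d f r : ℝ} (hf : 0 ≤ f) (hr : 0 ≤ r) :
    4 * f ^ α + 4 * d + f ^ (1 - α) ≤ eps2 α d f r := by
  have hc := cBar_nonneg (α := α) (f := f) (r := r) (by positivity)
  rw [eps2]
  linarith

variable {𝒳 Ω Ω' : Type*} [MeasurableSpace Ω] [MeasurableSpace Ω'] [Fintype 𝒳] [DecidableEq 𝒳]
  {Q : Matrix 𝒳 𝒳 ℝ} {P : 𝒳 → Measure Ω} {X : ℝ≥0 → Ω → 𝒳}
  {P' : 𝒳 → Measure Ω'} {X' : ℝ≥0 → Ω' → 𝒳} {π : 𝒳 → ℝ} {G : Set 𝒳} {α : ℝ} {R : ℝ≥0}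
  {d f r : ℝ}

omit [Fintype 𝒳] [DecidableEq 𝒳] in
lemma disjoint_basin : Disjoint (basin P X P' X' G R f α) G :=
  Set.disjoint_left.2 fun _ hx => hx.1

lemma killedSemigroup_mulVec_le_semigroup (hQ : IsRateMatrix Q) {φ : 𝒳 → ℝ} (hφ : 0 ≤ φ)
    (t : ℝ≥0) (x : 𝒳) :
    (killedSemigroup Q G t *ᵥ φ) x ≤ (semigroup Q t *ᵥ Gᶜ.indicator φ) x := by
  have hind : 0 ≤ Gᶜ.indicator φ := Set.indicator_nonneg fun x _ => hφ x
  have hkill : killedSemigroup Q G t *ᵥ φ = killedSemigroup Q G t *ᵥ Gᶜ.indicator φ := by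
    rw [← proj_mulVec, mulVec_mulVec, killedSemigroup, killedKernel_mul_proj]
  have hle := entrance_mul_add_le hQ (Set.empty_subset G) 0 t (φ := Gᶜ.indicator φ) (l := 0)
    (fun u _ b _ => dotProduct_nonneg_of_nonneg
      ((isSubMarkovSemigroup_killedSemigroup hQ ∅).nonneg u b) hind) x
  rw [killedSemigroup_empty, semigroup, NNReal.coe_zero, zero_smul, NormedSpace.exp_zero,
    one_mulVec, mul_zero, zero_add, zero_add] at hle
  exact (congrFun hkill x).trans_le hle

lemma killedSemigroup_le_semigroup (hQ : IsRateMatrix Q) (t : ℝ≥0) (x y : 𝒳) :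
    killedSemigroup Q G t x y ≤ semigroup Q t x y := by
  have hsingle : (0 : 𝒳 → ℝ) ≤ Pi.single y 1 := Pi.single_nonneg.2 zero_le_one
  calc killedSemigroup Q G t x y = (killedSemigroup Q G t *ᵥ Pi.single y 1) x := by
        rw [mulVec_single_one, col_apply]
    _ ≤ (semigroup Q t *ᵥ Gᶜ.indicator (Pi.single y 1)) x :=
        killedSemigroup_mulVec_le_semigroup hQ hsingle t x
    _ ≤ (semigroup Q t *ᵥ Pi.single y 1) x := dotProduct_le_dotProduct_of_nonneg_left
        (Set.indicator_le_self' fun z _ => hsingle z) (exp_smul_nonneg hQ.nonneg t.2 x)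
    _ = semigroup Q t x y := by rw [mulVec_single_one, col_apply]

variable (hX : IsMarkovChain Q P X) (hQ : IsRateMatrix Q)
include hX hQ

lemma IsMarkovChain.real_hit_le_eq (x : 𝒳) (t : ℝ≥0) :
    (P x).real {ω | hit X G ω ≤ t} = 1 - mass (killedSemigroup Q G) t x := by
  have := hX.prob x
  rw [← hX.real_lt_hit_eq hQ, ← probReal_compl_eq_one_sub (hX.measurableSet_lt_hit G t)]
  simp only [Set.compl_ofPred, not_lt]

lemma mass_ge_of_mem_basin {x : 𝒳} (hx : x ∈ basin P X P' X' G R f α) :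
    1 - 2 * f ^ α ≤ mass (killedSemigroup Q G) (2 * R) x := by
  have hmem := hx.2
  rw [hX.real_hit_le_eq hQ] at hmem
  have hrev : 0 ≤ (P' x).real {ω | hit X' G ω ≤ ((2 * R : ℝ≥0) : ℝ≥0∞)} := measureReal_nonneg
  linarith

lemma mass_union_basin_le (hH : HpG P X P' X' π G α R d f r) (x : 𝒳) :
    mass (killedSemigroup Q (G ∪ basin P X P' X' G R f α)) R x ≤ r := by
  rw [← hX.real_lt_hit_eq hQ, Set.union_comm]
  exact (hH.recurrence x).le

lemma sum_abs_semigroup_sub_le (hH : HpG P X P' X' π G α R d f r) {x x' : 𝒳}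
    (hx : x ∈ basin P X P' X' G R f α) (hx' : x' ∈ basin P X P' X' G R f α) :
    ∑ y, |semigroup Q R x y - semigroup Q R x' y| ≤ 2 * d := by
  have htherm := hH.thermalization x hx x' hx'
  rw [dTV, hX.evol_eq_semigroup hQ, hX.evol_eq_semigroup hQ] at htherm
  linarith

lemma sum_abs_killedSemigroup_sub_le (hH : HpG P X P' X' π G α R d f r) {x x' : 𝒳}
    (hx : x ∈ basin P X P' X' G R f α) (hx' : x' ∈ basin P X P' X' G R f α) :
    ∑ y, |killedSemigroup Q G R x y - killedSemigroup Q G R x' y| ≤ 2 * d + 4 * f ^ α := by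
  have hloss : ∀ z ∈ basin P X P' X' G R f α,
      ∑ y, (semigroup Q R z y - killedSemigroup Q G R z y) ≤ 2 * f ^ α := fun z hz => by
    have hfull : ∑ y, semigroup Q R z y = 1 :=
      (dotProduct_one _).symm.trans (congrFun (semigroup_mulVec_one hQ R) z)
    have hanti := (isSubMarkovSemigroup_killedSemigroup hQ G).mass_anti
      (le_mul_of_one_le_left R.2 one_le_two : R ≤ 2 * R) z
    rw [Finset.sum_sub_distrib, hfull, sum_eq_mass]
    linarith [mass_ge_of_mem_basin hX hQ hz]
  have hentry : ∀ y, |killedSemigroup Q G R x y - killedSemigroup Q G R x' y| ≤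
      |semigroup Q R x y - semigroup Q R x' y| + (semigroup Q R x y - killedSemigroup Q G R x y) +
        (semigroup Q R x' y - killedSemigroup Q G R x' y) := fun y => by
    have hle := killedSemigroup_le_semigroup (G := G) hQ R x y
    have hle' := killedSemigroup_le_semigroup (G := G) hQ R x' y
    rw [abs_le]
    constructor <;> linarith [le_abs_self (semigroup Q R x y - semigroup Q R x' y),
      neg_abs_le (semigroup Q R x y - semigroup Q R x' y)]
  refine (Finset.sum_le_sum fun y _ => hentry y).trans ?_
  rw [Finset.sum_add_distrib, Finset.sum_add_distrib]
  linarith [hloss x hx, hloss x' hx', sum_abs_semigroup_sub_le hX hQ hH hx hx']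

variable (hπ : IsInvariant Q π) (hpos : ∀ x, 0 < π x)
  (hX' : IsMarkovChain (reversedRates Q π) P' X')
include hX' hπ

lemma lt_of_notMem_basin {x : 𝒳} (hx : x ∉ basin P X P' X' G R f α) (hxG : x ∉ G) :
    f ^ α < 1 - 1 / 2 * (mass (killedSemigroup Q G) (2 * R) x +
      mass (killedSemigroup (reversedRates Q π) G) (2 * R) x) := by
  by_contra! hle
  refine hx ⟨hxG, ?_⟩
  rw [hX.real_hit_le_eq hQ, hX'.real_hit_le_eq (isRateMatrix_reversedRates hQ hπ)]
  linarith

variable (hGc : Gᶜ.Nonempty) (hH : HpG P X P' X' π G α R d f r)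
include hpos hGc hH

/-- Markov's inequality for the mean of the escape probabilities of the chain and of its reversal:
these have the same average under `π_A`. -/
lemma restricted_compl_basin_le :
    restricted π Gᶜ ⬝ᵥ (basin P X P' X' G R f α)ᶜ.indicator 1 ≤ f ^ (1 - α) := by
  have hf := hH.f_mem.1
  have hν0 := restricted_nonneg hpos (A := Gᶜ)
  have hsub := isSubMarkovSemigroup_killedSemigroup hQ G
  have hsub' := isSubMarkovSemigroup_killedSemigroup (isRateMatrix_reversedRates hQ hπ) G
  have hν1 : restricted π Gᶜ ⬝ᵥ 1 = 1 := (dotProduct_one _).trans (sum_restricted hpos hGc)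
  have hslow : 1 - restricted π Gᶜ ⬝ᵥ mass (killedSemigroup Q G) (2 * R) ≤ f := by
    have := hX.prob
    refine le_of_eq_of_le ?_ hH.slowEscape
    rw [real_fromLaw hν0, ← hν1, ← dotProduct_sub]
    exact congrArg _ (funext fun x => (hX.real_hit_le_eq hQ x _).symm)
  have hmarkov : ∀ x, restricted π Gᶜ x * (f ^ α * (basin P X P' X' G R f α)ᶜ.indicator 1 x) ≤
      restricted π Gᶜ x * (1 - 1 / 2 * (mass (killedSemigroup Q G) (2 * R) x +
        mass (killedSemigroup (reversedRates Q π) G) (2 * R) x)) := by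
    intro x
    by_cases hxG : x ∈ G
    · rw [restricted, Set.indicator_of_notMem (by simpa using hxG), zero_div, zero_mul, zero_mul]
    refine mul_le_mul_of_nonneg_left ?_ (hν0 x)
    by_cases hx : x ∈ basin P X P' X' G R f α
    · rw [Set.indicator_of_notMem (by simpa using hx), mul_zero]
      linarith [hsub.mass_le (2 * R) x, hsub'.mass_le (2 * R) x]
    · rw [Set.indicator_of_mem hx, Pi.one_apply, mul_one]
      exact (lt_of_notMem_basin hX hQ hπ hX' hx hxG).le
  rw [Real.rpow_sub hf, Real.rpow_one, le_div_iff₀ (Real.rpow_pos_of_pos hf α), mul_comm,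
    ← smul_eq_mul, ← dotProduct_smul]
  calc restricted π Gᶜ ⬝ᵥ (f ^ α • (basin P X P' X' G R f α)ᶜ.indicator 1)
      ≤ restricted π Gᶜ ⬝ᵥ (1 - (1 / 2 : ℝ) • (mass (killedSemigroup Q G) (2 * R) +
          mass (killedSemigroup (reversedRates Q π) G) (2 * R))) :=
        Finset.sum_le_sum fun x _ => hmarkov x
    _ = 1 - restricted π Gᶜ ⬝ᵥ mass (killedSemigroup Q G) (2 * R) := by
        rw [dotProduct_sub, hν1, dotProduct_smul, dotProduct_add,
          restricted_dotProduct_mass_reversedRates hpos, smul_eq_mul]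
        ring
    _ ≤ f := hslow

lemma restricted_basin_ge :
    1 - f ^ (1 - α) ≤ restricted π Gᶜ ⬝ᵥ (basin P X P' X' G R f α).indicator 1 := by
  have hsum : restricted π Gᶜ ⬝ᵥ (basin P X P' X' G R f α).indicator 1 +
      restricted π Gᶜ ⬝ᵥ (basin P X P' X' G R f α)ᶜ.indicator 1 = 1 := by
    rw [← dotProduct_add, Set.indicator_self_add_compl, dotProduct_one,
      sum_restricted hpos hGc]
  linarith [restricted_compl_basin_le hX hQ hπ hpos hX' hGc hH]

lemma restricted_basin_ge_one_sub_two_mul : 1 - 2 * (r + eps2 α d f r) ≤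
    restricted π Gᶜ ⬝ᵥ (basin P X P' X' G R f α).indicator 1 := by
  have heps := le_eps2 (α := α) (d := d) hH.f_mem.1.le hH.r_mem.1.le
  have hfα : 0 < f ^ α := Real.rpow_pos_of_pos hH.f_mem.1 α
  have hfα' : 0 < f ^ (1 - α) := Real.rpow_pos_of_pos hH.f_mem.1 _
  linarith [restricted_basin_ge hX hQ hπ hpos hX' hGc hH, hH.d_mem.1, hH.r_mem.1]

lemma semigroup_compl_basin_le (hsmall : f ^ (1 - α) ≤ 1 / 2) (u : ℝ≥0) {b : 𝒳}
    (hb : b ∈ basin P X P' X' G R f α) :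
    (semigroup Q (R + u) *ᵥ Gᶜ.indicator ((basin P X P' X' G R f α)ᶜ.indicator 1)) b ≤
      2 * d + 2 * f ^ (1 - α) := by
  have hS : IsSubMarkovSemigroup (semigroup Q) :=
    killedSemigroup_empty (Q := Q) ▸ isSubMarkovSemigroup_killedSemigroup hQ ∅
  set φ : 𝒳 → ℝ := (basin P X P' X' G R f α)ᶜ.indicator 1
  have hφ : 0 ≤ φ := Set.indicator_nonneg fun _ _ => zero_le_one
  have hφG : 0 ≤ Gᶜ.indicator φ := Set.indicator_nonneg fun x _ => hφ x
  have hφG1 : ∀ y, |Gᶜ.indicator φ y| ≤ 1 := fun y => by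
    rw [abs_of_nonneg (hφG y)]
    exact (Set.indicator_le_self' (fun x _ => hφ x) y).trans
      (Set.indicator_le_self' (fun _ _ => zero_le_one) y)
  have hclose : ∀ b' ∈ basin P X P' X' G R f α,
      (semigroup Q (R + u) *ᵥ Gᶜ.indicator φ) b - 2 * d ≤
        (semigroup Q (R + u) *ᵥ Gᶜ.indicator φ) b' := fun b' hb' => by
    have htherm := sum_abs_semigroup_sub_le hX hQ hH hb hb'
    have hdiff := (le_abs_self _).trans <|
      abs_dotProduct_le_sum_abs_mul (u := semigroup Q R b - semigroup Q R b')
        (hS.abs_mulVec_le_of_forall_abs_le u hφG1)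
    rw [sub_dotProduct, mul_one] at hdiff
    rw [hS.mulVec_add]
    exact sub_le_comm.1 (hdiff.trans htherm)
  have haverage : ((semigroup Q (R + u) *ᵥ Gᶜ.indicator φ) b - 2 * d) *
      (restricted π Gᶜ ⬝ᵥ (basin P X P' X' G R f α).indicator 1) ≤ f ^ (1 - α) := by
    rw [← smul_eq_mul, ← dotProduct_smul]
    refine le_trans (dotProduct_le_dotProduct_of_nonneg_left (fun x => ?_)
      (restricted_nonneg hpos)) ((restricted_dotProduct_semigroup_le hpos hQ hπ hφ (R + u)).trans
        (restricted_compl_basin_le hX hQ hπ hpos hX' hGc hH))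
    by_cases hx : x ∈ basin P X P' X' G R f α
    · simpa [hx] using hclose x hx
    · have hnonneg : 0 ≤ (semigroup Q (R + u) *ᵥ Gᶜ.indicator φ) x :=
        dotProduct_nonneg_of_nonneg (hS.nonneg (R + u) x) hφG
      simpa [hx] using hnonneg
  have hge := restricted_basin_ge hX hQ hπ hpos hX' hGc hH
  have hfpos : 0 < f ^ (1 - α) := Real.rpow_pos_of_pos hH.f_mem.1 _
  by_contra! hlt
  nlinarith

lemma killedSemigroup_compl_basin_le (hsmall : f ^ (1 - α) ≤ 1 / 2) {s : ℝ≥0} (hs : R ≤ s) {b : 𝒳}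
    (hb : b ∈ basin P X P' X' G R f α) :
    (killedSemigroup Q G s *ᵥ (basin P X P' X' G R f α)ᶜ.indicator 1) b ≤
      2 * d + 2 * f ^ (1 - α) := by
  obtain ⟨u, rfl⟩ := exists_add_of_le hs
  exact (killedSemigroup_mulVec_le_semigroup hQ (Set.indicator_nonneg fun _ _ => zero_le_one) _
    b).trans (semigroup_compl_basin_le hX hQ hπ hpos hX' hGc hH hsmall u hb)

lemma killedSemigroup_two_mul_compl_basin_le (hsmall : f ^ (1 - α) ≤ 1 / 2) (x : 𝒳) :
    (killedSemigroup Q G (2 * R) *ᵥ (basin P X P' X' G R f α)ᶜ.indicator 1) x ≤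
      r + (2 * d + 2 * f ^ (1 - α)) := by
  set B := basin P X P' X' G R f α
  have hsub := isSubMarkovSemigroup_killedSemigroup hQ G
  have hbound : 0 ≤ 2 * d + 2 * f ^ (1 - α) := by
    linarith [hH.d_mem.1, Real.rpow_pos_of_pos hH.f_mem.1 (1 - α)]
  have hind : ∀ y, |(Bᶜ.indicator 1 : 𝒳 → ℝ) y| ≤ 1 := fun y =>
    (abs_of_nonneg (Set.indicator_nonneg (fun _ _ => zero_le_one) y)).trans_le
      (Set.indicator_le_self' (fun _ _ => zero_le_one) y)
  have hle := killedSemigroup_mulVec_le hQ (Set.disjoint_left.2 fun _ hx => hx.1 : Disjoint B G) R R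
    (φ := Bᶜ.indicator 1) (hsub.abs_mulVec_le_of_forall_abs_le R hind)
    (fun u hu b hb => killedSemigroup_compl_basin_le hX hQ hπ hpos hX' hGc hH hsmall hu.1 hb) x
  rw [← two_mul, one_mul] at hle
  exact hle.trans <| add_le_add (mass_union_basin_le hX hQ hH x) <|
    mul_le_of_le_one_left hbound (entrance_le_one hQ Set.subset_union_right R x)

/-- The dominant constraint on `κ` is `leave`, which costs `r + 2 d + 2 f^{1-α}`. -/
theorem isReturnKernel_killedSemigroup (hε : r + eps2 α d f r ≤ 1 / 200) :
    IsReturnKernel (killedSemigroup Q G) (basin P X P' X' G R f α)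
      (entrance Q (G ∪ basin P X P' X' G R f α) (basin P X P' X' G R f α) R) R
      (2 * (r + eps2 α d f r)) := by
  have hd := hH.d_mem.1
  have hr := hH.r_mem.1
  have heps := le_eps2 (α := α) (d := d) hH.f_mem.1.le hr.le
  have hfα : 0 < f ^ α := Real.rpow_pos_of_pos hH.f_mem.1 α
  have hfα' : 0 < f ^ (1 - α) := Real.rpow_pos_of_pos hH.f_mem.1 _
  have hBG : Disjoint (basin P X P' X' G R f α) G := disjoint_basin
  have hrec := mass_union_basin_le hX hQ hH
  have hsub := isSubMarkovSemigroup_killedSemigroup hQ G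
  refine { hsub with
    κ_nonneg := by linarith
    κ_le := by linarith
    R_pos := one_pos.trans hH.R_gt
    nonempty := ?_
    q_nonneg := entrance_nonneg hQ Set.subset_union_right R.2
    q_le := entrance_le_one hQ Set.subset_union_right R
    lower := fun s x L hL => entrance_mul_le_mass hQ hBG s R hL x
    upper := fun s x H U hHs hU => ?_
    ret := fun x => ?_
    slow := fun b hb => by linarith [mass_ge_of_mem_basin hX hQ hb]
    therm := fun x hx x' hx' => by
      linarith [sum_abs_killedSemigroup_sub_le hX hQ hH hx hx']
    leave := fun x => (killedSemigroup_two_mul_compl_basin_le hX hQ hπ hpos hX' hGc hH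
      (by linarith) x).trans (by linarith) }
  · by_contra hempty
    have hge := restricted_basin_ge hX hQ hπ hpos hX' hGc hH
    rw [Set.not_nonempty_iff_eq_empty.1 hempty, Set.indicator_empty] at hge
    have hzero : restricted π Gᶜ ⬝ᵥ (fun _ => 0) = 0 := dotProduct_zero _
    linarith
  · have hH0 : 0 ≤ H := (hsub.mass_nonneg s x).trans (hHs x)
    have hle := killedSemigroup_mulVec_le hQ hBG s R (φ := 1) (H := H) (l := U)
      (fun y => (abs_of_nonneg (hsub.mass_nonneg s y)).trans_le (hHs y))
      (fun u hu b hb => (hsub.mass_anti hu.1 b).trans (hU b hb)) x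
    refine hle.trans ?_
    nlinarith [hrec x]
  · have hone := killedSemigroup_mulVec_le hQ hBG 0 R (φ := 1) (H := 1) (l := 1)
      (fun y => (abs_of_nonneg (hsub.mass_nonneg 0 y)).trans_le (hsub.mass_le 0 y))
      (fun u _ b _ => hsub.mass_le u b) x
    rw [zero_add] at hone
    have hmass : mass (killedSemigroup Q G) R x ≤ _ := hone
    linarith [hrec x]

end Basin

section ExponentialTail

lemma denseRange_nnratCast : DenseRange ((↑) : ℚ≥0 → ℝ≥0) := by
  refine dense_of_exists_between fun a b hab => ?_
  obtain ⟨q, hq, haq, hqb⟩ := NNReal.lt_iff_exists_rat_btwn a b |>.1 hab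
  lift q to ℚ≥0 using hq
  have hcast : Real.toNNReal ((q : ℚ) : ℝ) = (q : ℝ≥0) := by
    rw [Rat.cast_nnratCast]
    exact Real.toNNReal_of_nonneg q.cast_nonneg
  rw [hcast] at haq hqb
  exact ⟨q, ⟨q, rfl⟩, haq, hqb⟩

lemma map_nnreal_eq_mul (L : ℝ≥0 →+ ℝ) (hL : Continuous L) (t : ℝ≥0) : L t = t * L 1 := by
  refine congrFun (denseRange_nnratCast.equalizer hL
    (NNReal.continuous_coe.mul continuous_const) (funext fun q => ?_)) t
  have hmap := map_nnratCast_smul L ℝ≥0 ℝ q 1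
  rwa [smul_eq_mul, mul_one, smul_eq_mul] at hmap

lemma exists_eq_exp_neg_div {E : ℝ≥0 → ℝ} (hcont : Continuous E) (hpos : ∀ t, 0 < E t)
    (hadd : ∀ s t, E (s + t) = E s * E t) (hlt : E 1 < 1) :
    ∃ T > 0, ∀ t : ℝ≥0, E t = Real.exp (-(t / T)) := by
  let L : ℝ≥0 →+ ℝ := AddMonoidHom.mk' (fun t => -Real.log (E t)) fun s t => by
    rw [hadd, Real.log_mul (hpos s).ne' (hpos t).ne', neg_add]
  have hL : Continuous L := (hcont.log fun t => (hpos t).ne').neg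
  have hL1 : 0 < L 1 := neg_pos.2 (Real.log_neg (hpos 1) hlt)
  refine ⟨1 / L 1, one_div_pos.2 hL1, fun t => ?_⟩
  rw [div_div_eq_mul_div, div_one, ← map_nnreal_eq_mul L hL]
  exact ((congrArg Real.exp (neg_neg _)).trans (Real.exp_log (hpos t))).symm

variable {Ω : Type*} [MeasurableSpace Ω] {m : Measure Ω} {τ : Ω → ℝ≥0∞} {T : ℝ}

lemma ae_ne_top_of_exp_tail [IsFiniteMeasure m] (hT : 0 < T)
    (htail : ∀ t : ℝ≥0, m.real {ω | (t : ℝ≥0∞) < τ ω} = Real.exp (-(t / T))) :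
    ∀ᵐ ω ∂m, τ ω ≠ ⊤ := by
  have hlim : Tendsto (fun n : ℕ => Real.exp (-((n : ℝ≥0) / T))) atTop (𝓝 0) := by
    refine Real.tendsto_exp_neg_atTop_nhds_zero.comp ?_
    simpa using (tendsto_natCast_atTop_atTop (R := ℝ)).atTop_div_const hT
  have hzero : m.real {ω | τ ω = ⊤} ≤ 0 := by
    refine ge_of_tendsto' hlim fun n => ?_
    rw [← htail]
    refine measureReal_mono fun ω (hω : τ ω = ⊤) => ?_
    rw [Set.mem_ofPred_eq, hω]
    exact ENNReal.coe_lt_top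
  simpa [ae_iff] using (measureReal_eq_zero_iff).1 (hzero.antisymm measureReal_nonneg)

lemma lintegral_eq_of_exp_tail [IsFiniteMeasure m] (hτ : Measurable τ) (hT : 0 < T)
    (htail : ∀ t : ℝ≥0, m.real {ω | (t : ℝ≥0∞) < τ ω} = Real.exp (-(t / T))) :
    ∫⁻ ω, τ ω ∂m = ENNReal.ofReal T := by
  have htop := ae_ne_top_of_exp_tail hT htail
  have hrate : -T⁻¹ < 0 := neg_lt_zero.2 (inv_pos.2 hT)
  have hreal : ∀ t ∈ Set.Ioi (0 : ℝ), m {ω | t < (τ ω).toReal} =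
      ENNReal.ofReal (Real.exp (-T⁻¹ * t)) := fun t ht => by
    have hset : m {ω | t < (τ ω).toReal} = m {ω | (t.toNNReal : ℝ≥0∞) < τ ω} := by
      refine measure_congr ?_
      filter_upwards [htop] with ω hω
      exact propext (ENNReal.ofReal_lt_iff_lt_toReal (le_of_lt ht) hω).symm
    rw [hset, ← ofReal_measureReal, htail, Real.coe_toNNReal t (le_of_lt ht), neg_mul,
      ← div_eq_inv_mul]
  calc ∫⁻ ω, τ ω ∂m = ∫⁻ ω, ENNReal.ofReal (τ ω).toReal ∂m :=
        lintegral_congr_ae (htop.mono fun ω hω => (ENNReal.ofReal_toReal hω).symm)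
    _ = ∫⁻ t in Set.Ioi 0, m {ω | t < (τ ω).toReal} :=
        lintegral_eq_lintegral_meas_lt m (ae_of_all _ fun ω => ENNReal.toReal_nonneg)
          hτ.ennreal_toReal.aemeasurable
    _ = ∫⁻ t in Set.Ioi 0, ENNReal.ofReal (Real.exp (-T⁻¹ * t)) :=
        setLIntegral_congr_fun measurableSet_Ioi hreal
    _ = ENNReal.ofReal T := by
        rw [← ofReal_integral_eq_lintegral_ofReal (integrableOn_exp_mul_Ioi hrate 0)
          (ae_of_all _ fun t => (Real.exp_pos _).le), integral_exp_mul_Ioi hrate]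
        simp

omit [MeasurableSpace Ω] in
lemma setOf_le_div_eq (τ : Ω → ℝ≥0∞) (hT : 0 < T) (s : ℝ≥0) :
    {ω | ENNReal.ofReal (s / T) ≤ τ ω / ENNReal.ofReal T} = {ω | (s : ℝ≥0∞) ≤ τ ω} := by
  ext ω
  rw [Set.mem_ofPred_eq, ENNReal.le_div_iff_mul_le (Or.inl (ENNReal.ofReal_pos.2 hT).ne')
    (Or.inl ENNReal.ofReal_ne_top), ← ENNReal.ofReal_mul (by positivity), div_mul_cancel₀ _ hT.ne',
    ENNReal.ofReal_coe_nnreal]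
  rfl

lemma exists_eq_coe_div (hT : 0 < T) {t : ℝ} (ht : 0 ≤ t) : ∃ s : ℝ≥0, t = s / T :=
  ⟨⟨t * T, by positivity⟩, (mul_div_cancel_right₀ t hT.ne').symm⟩

lemma abs_real_le_div_sub_exp_le [IsProbabilityMeasure m] (hT : 0 < T) {ε : ℝ} (hε : 0 ≤ ε)
    (htail : ∀ s : ℝ≥0, 0 < s → |m.real {ω | (s : ℝ≥0∞) ≤ τ ω} - Real.exp (-(s / T))| ≤
      ε * Real.exp (-(s / T))) {t : ℝ} (ht : 0 ≤ t) :
    |m.real {ω | ENNReal.ofReal t ≤ τ ω / ENNReal.ofReal T} - Real.exp (-t)| ≤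
      ε * Real.exp (-t) := by
  obtain ⟨s, rfl⟩ := exists_eq_coe_div hT ht
  rw [setOf_le_div_eq τ hT]
  rcases (zero_le : 0 ≤ s).eq_or_lt with rfl | hs
  · simpa using hε
  · exact htail s hs

end ExponentialTail

section ChainTail

variable {𝒳 Ω : Type*} [MeasurableSpace Ω] [Fintype 𝒳] {P : 𝒳 → Measure Ω}

lemma isProbabilityMeasure_fromLaw [∀ x, IsProbabilityMeasure (P x)] {ν : 𝒳 → ℝ} (hν : 0 ≤ ν)
    (hν1 : ∑ x, ν x = 1) : IsProbabilityMeasure (fromLaw P ν) := by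
  constructor
  simp [fromLaw, Measure.finsetSum_apply, ← ENNReal.ofReal_sum_of_nonneg fun x _ => hν x, hν1]

variable [DecidableEq 𝒳] {Q : Matrix 𝒳 𝒳 ℝ} {X : ℝ≥0 → Ω → 𝒳} {G : Set 𝒳} {μ : 𝒳 → ℝ}

lemma continuous_mass_killedSemigroup (Q : Matrix 𝒳 𝒳 ℝ) (G : Set 𝒳) :
    Continuous (mass (killedSemigroup Q G)) :=
  ((continuous_killedKernel Q G).comp NNReal.continuous_coe).matrix_mulVec continuous_const

variable (hX : IsMarkovChain Q P X)
include hX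

lemma IsMarkovChain.measurable_hit (G : Set 𝒳) : Measurable (hit X G) := by
  refine measurable_of_Ioi fun a => ?_
  induction a using ENNReal.recTopCoe with
  | top => simp only [Set.Ioi_top, Set.preimage_empty, MeasurableSet.empty]
  | coe a => exact hX.measurableSet_lt_hit G a

variable (hQ : IsRateMatrix Q)
include hQ

lemma IsMarkovChain.real_le_hit_eq {s : ℝ≥0} (hs : 0 < s) (x : 𝒳) :
    (P x).real {ω | (s : ℝ≥0∞) ≤ hit X G ω} = mass (killedSemigroup Q G) s x := by
  have := hX.prob x
  have : (𝓝[<] s).NeBot := nhdsLT_neBot_of_exists_lt ⟨0, hs⟩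
  have hlim : Tendsto (fun v => mass (killedSemigroup Q G) v x) (𝓝[<] s)
      (𝓝 (mass (killedSemigroup Q G) s x)) :=
    (((continuous_apply x).comp (continuous_mass_killedSemigroup Q G)).tendsto s).mono_left
      nhdsWithin_le_nhds
  refine le_antisymm (ge_of_tendsto hlim ?_) ?_
  · filter_upwards [self_mem_nhdsWithin] with v hv
    rw [← hX.real_lt_hit_eq hQ]
    exact measureReal_mono fun ω hω => (ENNReal.coe_lt_coe.2 hv).trans_le hω
  · rw [← hX.real_lt_hit_eq hQ]
    exact measureReal_mono fun ω (hω : (s : ℝ≥0∞) < hit X G ω) => hω.le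

lemma condEvol_eq (x : 𝒳) (t : ℝ≥0) : condEvol (P x) X G t =
    fun y => killedSemigroup Q G t x y / mass (killedSemigroup Q G) t x := by
  ext y
  rw [condEvol, hX.real_lt_hit_eq hQ, ← hX.real_killed_eq hQ]

lemma condEvol_fromLaw {ν : 𝒳 → ℝ} (hν : 0 ≤ ν) (t : ℝ≥0) : condEvol (fromLaw P ν) X G t =
    fun y => (ν ᵥ* killedSemigroup Q G t) y / ν ⬝ᵥ mass (killedSemigroup Q G) t := by
  have := hX.prob
  ext y
  rw [condEvol, real_fromLaw hν, real_fromLaw hν]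
  simp only [hX.real_lt_hit_eq hQ, hX.real_killed_eq hQ]
  rfl

variable {π : 𝒳 → ℝ} (hpos : ∀ x, 0 < π x) {b : 𝒳} (hb : b ∉ G)
  (hlim : IsYaglomLimit (killedSemigroup Q G) b μ)
include hpos hb hlim

lemma IsYaglomLimit.isQuasiStationary : IsQuasiStationary P X π G μ := by
  have hν := restricted_nonneg hpos (A := Gᶜ)
  have hνb : 0 < restricted π Gᶜ b := by
    rw [restricted, Set.indicator_of_mem hb]
    exact div_pos (hpos b) (sum_indicator_pos hpos ⟨b, hb⟩)
  refine (hlim _ hν (sum_restricted hpos ⟨b, hb⟩) _ hνb fun t => ?_).congr fun t =>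
    (condEvol_fromLaw hX hQ hν t).symm
  exact Finset.single_le_sum (f := fun x => restricted π Gᶜ x * mass (killedSemigroup Q G) t x)
    (fun x _ => mul_nonneg (hν x) ((isSubMarkovSemigroup_killedSemigroup hQ G).mass_nonneg t x))
    (Finset.mem_univ b)

omit hpos in
lemma IsYaglomLimit.tendsto_condEvol (hirr : IsIrreducibleOn Q Gᶜ) {x : 𝒳} (hx : x ∉ G) :
    Tendsto (fun t => condEvol (P x) X G t) atTop (𝓝 μ) := by
  have hS := isSubMarkovSemigroup_killedSemigroup hQ G
  have hmass : ∀ t, killedSemigroup Q G 1 x b * mass (killedSemigroup Q G) t b ≤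
      Pi.single x 1 ⬝ᵥ mass (killedSemigroup Q G) t := fun t => by
    rw [single_one_dotProduct]
    refine le_trans ?_ (hS.mass_anti (le_add_self : t ≤ 1 + t) x)
    rw [hS.mass_add]
    exact Finset.single_le_sum
      (f := fun z => killedSemigroup Q G 1 x z * mass (killedSemigroup Q G) t z)
      (fun z _ => mul_nonneg (hS.nonneg 1 x z) (hS.mass_nonneg t z)) (Finset.mem_univ b)
  refine (hlim (Pi.single x 1) (Pi.single_nonneg.2 zero_le_one) (Fintype.sum_pi_single' x 1) _
    (hirr.killedSemigroup_pos hQ one_pos hx hb) hmass).congr fun t => ?_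
  rw [condEvol_eq hX hQ, single_one_dotProduct, single_one_vecMul]
  rfl

lemma IsYaglomLimit.isAveragedLimit (hirr : IsIrreducibleOn Q Gᶜ) : IsAveragedLimit P X π G μ := by
  refine tendsto_pi_nhds.2 fun y => ?_
  have hterm : ∀ x, Tendsto (fun t => restricted π Gᶜ x * condEvol (P x) X G t y) atTop
      (𝓝 (restricted π Gᶜ x * μ y)) := fun x => by
    by_cases hx : x ∈ G
    · simp only [restricted, Set.indicator_of_notMem (Set.notMem_compl_iff.2 hx), zero_div,
        zero_mul, tendsto_const_nhds]
    · exact (tendsto_pi_nhds.1 (hlim.tendsto_condEvol hX hQ hb hirr hx) y).const_mul _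
  have hsum := tendsto_finsetSum Finset.univ fun x (_ : x ∈ Finset.univ) => hterm x
  rwa [← Finset.sum_mul, sum_restricted hpos ⟨b, hb⟩, one_mul] at hsum

end ChainTail

section ExitTime

variable {𝒳 Ω : Type*} [MeasurableSpace Ω] {P : 𝒳 → Measure Ω} {X : ℝ≥0 → Ω → 𝒳} {G B : Set 𝒳}
  {R : ℝ≥0} {κ T : ℝ} {μ : 𝒳 → ℝ}

/-- The probability `p_x` of surviving until time `2R` after a visit to `G ∪ B` before time `R`. -/
def returnProb (P : 𝒳 → Measure Ω) (X : ℝ≥0 → Ω → 𝒳) (G B : Set 𝒳) (R : ℝ≥0) (x : 𝒳) : ℝ :=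
  (P x).real {ω | ((2 * R : ℝ≥0) : ℝ≥0∞) < hit X G ω ∧ hit X (G ∪ B) ω ≤ (R : ℝ≥0∞)}

lemma returnProb_mul_exp_le [∀ x, IsProbabilityMeasure (P x)] (hT : 0 < T) {t : ℝ}
    (ht : 0 ≤ t) (htR : t ≤ R / T) (x : 𝒳) : returnProb P X G B R x * Real.exp (-t) ≤
      (P x).real {ω | ENNReal.ofReal t ≤ hit X G ω / ENNReal.ofReal T} := by
  obtain ⟨s, rfl⟩ := exists_eq_coe_div hT ht
  have hsR : s ≤ 2 * R := by
    have hle : s ≤ R := NNReal.coe_le_coe.1 ((div_le_div_iff_of_pos_right hT).1 htR)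
    exact hle.trans (le_mul_of_one_le_left zero_le one_le_two)
  rw [setOf_le_div_eq _ hT]
  refine (mul_le_of_le_one_right measureReal_nonneg (Real.exp_le_one_iff.2 (neg_nonpos.2 ht))).trans
    (measureReal_mono fun ω hω => ?_)
  exact (ENNReal.coe_le_coe.2 hsR).trans hω.1.le

variable [Fintype 𝒳] [DecidableEq 𝒳] {Q : Matrix 𝒳 𝒳 ℝ}
  (hX : IsMarkovChain Q P X) (hQ : IsRateMatrix Q)
include hX hQ

lemma IsEigenLaw.decay_one_lt_one (hirr : IsIrreducibleRate Q) (hG : G.Nonempty)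
    (hμ : IsEigenLaw (killedSemigroup Q G) μ) : decay (killedSemigroup Q G) μ 1 < 1 := by
  obtain ⟨g, hg⟩ := hG
  have hmass : ∀ x, mass (killedSemigroup Q G) 1 x < 1 := fun x => by
    linarith [hX.mass_add_semigroup_le_one hQ hg 1 x, hirr.semigroup_pos hQ one_pos x g]
  obtain ⟨y, hy⟩ : ∃ y, 0 < μ y := by
    by_contra! hle
    exact (Finset.sum_nonpos fun y _ => hle y).not_gt (hμ.sum_one ▸ one_pos)
  rw [← hμ.sum_one]
  exact Finset.sum_lt_sum (fun x _ => mul_le_of_le_one_right (hμ.nonneg x) (hmass x).le)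
    ⟨y, Finset.mem_univ y, mul_lt_of_lt_one_right hy (hmass y)⟩

lemma lintegral_hit_eq (hμ : IsEigenLaw (killedSemigroup Q G) μ) (hT : 0 < T)
    (hexp : ∀ t : ℝ≥0, decay (killedSemigroup Q G) μ t = Real.exp (-(t / T))) :
    ∫⁻ ω, hit X G ω ∂(fromLaw P μ) = ENNReal.ofReal T := by
  have := hX.prob
  have := isProbabilityMeasure_fromLaw (P := P) hμ.nonneg hμ.sum_one
  refine lintegral_eq_of_exp_tail (hX.measurable_hit G) hT fun t => ?_
  simp only [real_fromLaw hμ.nonneg, hX.real_lt_hit_eq hQ]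
  exact hexp t

lemma returnProb_le_entrance (hBG : Disjoint B G) (x : 𝒳) :
    returnProb P X G B R x ≤ entrance Q (G ∪ B) B R x := by
  rw [returnProb, two_mul, hX.real_lt_hit_and_hit_le_eq hQ Set.subset_union_left]
  exact mass_sub_le_entrance hQ hBG R R x

namespace IsReturnKernel

variable (h : IsReturnKernel (killedSemigroup Q G) B (entrance Q (G ∪ B) B R) R κ)
include h

lemma entrance_mul_le_returnProb (hBG : Disjoint B G) (x : 𝒳) :
    entrance Q (G ∪ B) B R x * (1 - κ) ≤ returnProb P X G B R x := by
  rw [returnProb, two_mul, hX.real_lt_hit_and_hit_le_eq hQ Set.subset_union_left]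
  exact entrance_mul_le_mass_sub hQ hBG R R (fun b hb => two_mul R ▸ h.slow b hb) x

variable (hμ : IsEigenLaw (killedSemigroup Q G) μ)
  (hR : 1 - 2 * κ ≤ decay (killedSemigroup Q G) μ R)
include hμ hR

lemma exists_decay_eq_exp (hirr : IsIrreducibleRate Q) (hG : G.Nonempty) :
    ∃ T > 0, ∀ t : ℝ≥0, decay (killedSemigroup Q G) μ t = Real.exp (-(t / T)) :=
  exists_eq_exp_neg_div (continuous_const.dotProduct (continuous_mass_killedSemigroup Q G))
    (h.decay_pos hμ hR) (hμ.decay_add h.toIsSubMarkovSemigroup)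
    (hμ.decay_one_lt_one hX hQ hirr hG)

variable (hT : 0 < T) (hexp : ∀ t : ℝ≥0, decay (killedSemigroup Q G) μ t = Real.exp (-(t / T)))
include hT hexp

lemma abs_real_fromLaw_sub_exp_le {ν : 𝒳 → ℝ} (hν : 0 ≤ ν) (hν1 : ∑ x, ν x = 1)
    (hB : 1 - κ ≤ ν ⬝ᵥ B.indicator 1) {t : ℝ} (ht : 0 ≤ t) :
    |(fromLaw P ν).real {ω | ENNReal.ofReal t ≤ hit X G ω / ENNReal.ofReal T} - Real.exp (-t)| ≤
      100 * κ * Real.exp (-t) := by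
  have := hX.prob
  have := isProbabilityMeasure_fromLaw (P := P) hν hν1
  refine abs_real_le_div_sub_exp_le hT (mul_nonneg (by norm_num) h.κ_nonneg) (fun s hs => ?_) ht
  simp only [real_fromLaw hν, hX.real_le_hit_eq hQ hs, ← hexp]
  exact h.abs_average_sub_decay_le hμ hR s hν hν1 hB

lemma abs_real_sub_exp_le {b : 𝒳} (hb : b ∈ B) {t : ℝ} (ht : 0 ≤ t) :
    |(P b).real {ω | ENNReal.ofReal t ≤ hit X G ω / ENNReal.ofReal T} - Real.exp (-t)| ≤
      100 * κ * Real.exp (-t) := by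
  have := hX.prob
  refine abs_real_le_div_sub_exp_le hT (mul_nonneg (by norm_num) h.κ_nonneg) (fun s hs => ?_) ht
  rw [hX.real_le_hit_eq hQ hs, ← hexp]
  exact (h.abs_basin_sub_decay_le hμ hR s hb).trans <| mul_le_mul_of_nonneg_right
    (mul_le_mul_of_nonneg_right (by norm_num) h.κ_nonneg) (h.decay_pos hμ hR s).le

lemma abs_real_sub_returnProb_mul_exp_le (hBG : Disjoint B G) (x : 𝒳) {t : ℝ} (ht : R / T ≤ t) :
    |(P x).real {ω | ENNReal.ofReal t ≤ hit X G ω / ENNReal.ofReal T} -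
      returnProb P X G B R x * Real.exp (-t)| ≤ 100 * κ * Real.exp (-t) := by
  obtain ⟨s, rfl⟩ := exists_eq_coe_div hT ((by positivity : (0 : ℝ) ≤ R / T).trans ht)
  have hRs : R ≤ s := NNReal.coe_le_coe.1 ((div_le_div_iff_of_pos_right hT).1 ht)
  rw [setOf_le_div_eq _ hT, hX.real_le_hit_eq hQ (h.R_pos.trans_le hRs), ← hexp,
    ← tsub_add_cancel_of_le hRs]
  exact h.abs_mass_sub_mul_decay_le hμ hR _ x (h.entrance_mul_le_returnProb hX hQ hBG x)
    (returnProb_le_entrance hX hQ hBG x)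

lemma returnProb_mul_exp_sub_le (hBG : Disjoint B G) (x : 𝒳) {t : ℝ} (ht : 0 ≤ t) :
    returnProb P X G B R x * Real.exp (-t) - 100 * κ * Real.exp (-t) ≤
      (P x).real {ω | ENNReal.ofReal t ≤ hit X G ω / ENNReal.ofReal T} := by
  have := hX.prob
  rcases le_total (R / T) t with hlate | hearly
  · linarith [(abs_le.1 (h.abs_real_sub_returnProb_mul_exp_le hX hQ hμ hR hT hexp hBG x hlate)).1]
  · refine (sub_le_self _ ?_).trans (returnProb_mul_exp_le hT ht hearly x)
    exact mul_nonneg (mul_nonneg (by norm_num) h.κ_nonneg) (Real.exp_pos _).le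

end IsReturnKernel

end ExitTime

end HittingTime

end

open HittingTime in
theorem theorem3p6 :
    ∃ C η : ℝ, 0 < C ∧ 0 < η ∧
      ∀ (𝒳 : Type*) [Fintype 𝒳] [DecidableEq 𝒳]
        (Ω : Type*) [MeasurableSpace Ω] (Ω' : Type*) [MeasurableSpace Ω']
        (Q : Matrix 𝒳 𝒳 ℝ) (π : 𝒳 → ℝ)
        (P : 𝒳 → Measure Ω) (X : ℝ≥0 → Ω → 𝒳)
        (P' : 𝒳 → Measure Ω') (X' : ℝ≥0 → Ω' → 𝒳)
        (G : Set 𝒳) (α : ℝ) (R : ℝ≥0) (d f r : ℝ),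
        IsRateMatrix Q → IsIrreducibleRate Q → IsInvariant Q π →
        IsMarkovChain Q P X → IsMarkovChain (reversedRates Q π) P' X' →
        G.Nonempty → Gᶜ.Nonempty → α ∈ Set.Ioo (0 : ℝ) 1 →
        HpG P X P' X' π G α R d f r →
        r + 2 * f ^ α < 1 / 4 →
        r + eps2 α d f r ≤ η →
        ∃ (μs : 𝒳 → ℝ) (T ε : ℝ),
          IsQuasiStationary P X π G μs ∧
          (IsIrreducibleOn Q Gᶜ → IsAveragedLimit P X π G μs) ∧
          0 < T ∧ ∫⁻ ω, hit X G ω ∂(fromLaw P μs) = ENNReal.ofReal T ∧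
          0 ≤ ε ∧ ε ≤ C * (r + eps2 α d f r) ∧
          (∀ t : ℝ, 0 ≤ t →
            |(fromLaw P (restricted π Gᶜ)).real
                {ω | ENNReal.ofReal t ≤ hit X G ω / ENNReal.ofReal T} - Real.exp (-t)|
              ≤ ε * Real.exp (-t)) ∧
          (∀ t : ℝ, 0 ≤ t → ∀ x ∈ basin P X P' X' G R f α,
            |(P x).real {ω | ENNReal.ofReal t ≤ hit X G ω / ENNReal.ofReal T} - Real.exp (-t)|
              ≤ ε * Real.exp (-t)) ∧
          (∀ x ∉ basin P X P' X' G R f α,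
            (∀ t : ℝ, R / T ≤ t →
              |(P x).real {ω | ENNReal.ofReal t ≤ hit X G ω / ENNReal.ofReal T} -
                  (P x).real {ω | ((2 * R : ℝ≥0) : ℝ≥0∞) < hit X G ω ∧
                    hit X (G ∪ basin P X P' X' G R f α) ω ≤ (R : ℝ≥0∞)} * Real.exp (-t)|
                ≤ ε * Real.exp (-t)) ∧
            (∀ t : ℝ, 0 ≤ t →
              (P x).real {ω | ((2 * R : ℝ≥0) : ℝ≥0∞) < hit X G ω ∧
                    hit X (G ∪ basin P X P' X' G R f α) ω ≤ (R : ℝ≥0∞)} * Real.exp (-t) -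
                  ε * Real.exp (-t)
                ≤ (P x).real {ω | ENNReal.ofReal t ≤ hit X G ω / ENNReal.ofReal T})) := by
  refine ⟨200, 1 / 200, by norm_num, by norm_num, fun 𝒳 _ _ Ω _ Ω' _ Q π P X P' X' G α R d f r
    hQ hirr hπ hX hX' hG hGc _ hH _ hη => ?_⟩
  have hpos := hπ.pos hQ hirr
  have hB := restricted_basin_ge_one_sub_two_mul hX hQ hπ hpos hX' hGc hH
  have h := isReturnKernel_killedSemigroup hX hQ hπ hpos hX' hGc hH hη
  obtain ⟨b, hb⟩ := h.nonempty
  obtain ⟨μ, hμ, hR, hlim⟩ := h.exists_isEigenLaw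
  obtain ⟨T, hT, hexp⟩ := h.exists_decay_eq_exp hX hQ hμ hR hirr hG
  exact ⟨μ, T, 100 * (2 * (r + eps2 α d f r)),
    (hlim b hb).isQuasiStationary hX hQ hpos hb.1,
    (hlim b hb).isAveragedLimit hX hQ hpos hb.1,
    hT, lintegral_hit_eq hX hQ hμ hT hexp,
    mul_nonneg (by norm_num) h.κ_nonneg, by linarith,
    fun t => h.abs_real_fromLaw_sub_exp_le hX hQ hμ hR hT hexp (restricted_nonneg hpos)
      (sum_restricted hpos hGc) hB,
    fun t ht x hx => h.abs_real_sub_exp_le hX hQ hμ hR hT hexp hx ht,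
    fun x _ => ⟨fun t => h.abs_real_sub_returnProb_mul_exp_le hX hQ hμ hR hT hexp disjoint_basin x,
      fun t => h.returnProb_mul_exp_sub_le hX hQ hμ hR hT hexp disjoint_basin x⟩⟩
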